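/- A schema is a finite set of relation symbols with arities $\ge 0$; an instance over a schema $\mathbf S$ is a finite set of facts $R(a_1,\dots,a_n)$ with $R\in\mathbf S$ and $n=\mathrm{arity}(R)$. A Datalog program is a tuple $P=(\mathbf S_{in},\mathbf S_{out},\mathbf S_{aux},\Sigma)$ where $\mathbf S_{in},\mathbf S_{out},\mathbf S_{aux}$ are mutually disjoint schemas and $\Sigma$ is a finite set of rules $R_0(\mathbf x_0) \mathrel{:-} R_1(\mathbf x_1),\dots,R_n(\mathbf x_n)$ (the body being the finite set of atoms to the right of $:-$) with $R_0\in\mathbf S_{out}\cup\mathbf S_{aux}$, $R_1,\dots,R_n\in\mathbf S_{in}\cup\mathbf S_{aux}$, and such that every variable of $\mathbf x_0$ occurs in some $\mathbf x_i$, $i\ge 1$. For an $\mathbf S_{in}$-instance $I$, $\mathrm{chase}_P(I)$ is the union of the stages $\mathrm{chase}^0_P(I)=I$ and $\mathrm{chase}^{i+1}_P(I)$, the extension of $\mathrm{chase}^i_P(I)$ by all facts derivable from it by one application of a rule of $\Sigma$; and $P(I)$ is the set of $\mathbf S_{out}$-facts of $\mathrm{chase}_P(I)$. The program $P$ is \emph{tree-shaped}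 if, for each rule, the incidence graph of its body is acyclic; this is the bipartite multigraph whose nodes are the variables and the atoms of the body, with one edge between a variable $x$ and an atom for every occurrence of $x$ in that atom. The program $P$ is \emph{almost monadic} if there is a partial function $f$ assigning to relations $R\in\mathbf S_{aux}$ a position $f(R)\in\{1,\dots,\mathrm{arity}(R)\}$ (the articulation position of $R$; all other positions are non-articulation positions) such that, in every rule, each variable occurring in a non-articulation position of an auxiliary relation in the body occurs only once in the body and does not occur in the articulation position of an auxiliary relation in the head. A \emph{TAM Datalog program} is a tree-shaped, almost-monadic Datalog program. Corollary (TAM Datalog is closed under composition). Let $P_1$ and $P_2$ be TAM Datalog programs with $\mathbf S_{in}^{P_2}=\mathbf S_{out}^{P_1}$ (where $\mathbf S_{in}^{P_1}$ and $\mathbf S_{out}^{P_2}$ are taken to be disjoint, renaming symbols if necessary). Then there is a TAM Datalog program $P_3=(\mathbf S_{in}^{P_1},\mathbf S_{out}^{P_2},\mathbf S'_{aux},\Sigma')$ such that, for all $\mathbf S_{in}^{P_1}$-instances $I$, $P_3(I)=P_2(P_1(I))$. -/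

import Mathlib

namespace Datalog

/-- A schema: finitely many relation symbols, each with an arity (possibly `0`). -/
structure Schema where
  Rel : Type
  [finite_rel : Finite Rel]
  arity : Rel → ℕ

attribute [instance] Schema.finite_rel

/-- A fact `R(a₁, …, aₙ)` over the schema `S` with values in `D`.
When `D` is a type of variables, these are the atoms used in rules. -/
structure Fact (S : Schema) (D : Type*) where
  rel : S.Rel
  args : Fin (S.arity rel) → D

/-- The image of a fact under a map of values. -/
def Fact.map {S : Schema} {D E : Type*} (g : D → E) (f : Fact S D) : Fact S E :=
  ⟨f.rel, g ∘ f.args⟩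

/-- The occurrences of the value `x` in a set of facts: pairs of a fact and an
argument position of that fact holding `x`. -/
def occurrences {S : Schema} {D : Type*} (I : Set (Fact S D)) (x : D) :
    Set (Σ f : Fact S D, Fin (S.arity f.rel)) :=
  {o | o.1 ∈ I ∧ o.1.args o.2 = x}

/-- The simple graph underlying the incidence graph of a set of facts: a value is joined
to every fact it occurs in.  (Nodes that are not facts of `I`, or values
not occurring in `I`, are isolated and irrelevant for acyclicity.) -/
def incidenceGraph {S : Schema} {D : Type*} (I : Set (Fact S D)) :
    SimpleGraph (D ⊕ Fact S D) :=
  SimpleGraph.fromRel fun u v =>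
    match u, v with
    | Sum.inl x, Sum.inr f => f ∈ I ∧ x ∈ Set.range f.args
    | _, _ => False

/-- Acyclicity of the incidence multigraph, which has one edge for every occurrence of a
value in a fact: there are no two parallel edges (no value occurs twice in the same
fact), and the underlying simple graph has no cycle. -/
def IsAcyclic {S : Schema} {D : Type*} (I : Set (Fact S D)) : Prop :=
  (∀ f ∈ I, Function.Injective f.args) ∧ (incidenceGraph I).IsAcyclic

/-- The relation symbols of the disjoint union of an input, an output and an auxiliary schema. -/
inductive Sym (In Out Aux : Schema) : Type
  | inp : In.Rel → Sym In Out Aux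
  | out : Out.Rel → Sym In Out Aux
  | aux : Aux.Rel → Sym In Out Aux

/-- The arities of the symbols of the disjoint union of three schemas. -/
def Sym.arity {In Out Aux : Schema} : Sym In Out Aux → ℕ
  | .inp R => In.arity R
  | .out R => Out.arity R
  | .aux R => Aux.arity R

theorem Sym.finite (In Out Aux : Schema) : Finite (Sym In Out Aux) :=
  Finite.of_surjective
    (fun s : In.Rel ⊕ Out.Rel ⊕ Aux.Rel =>
      match s with
      | .inl R => Sym.inp R
      | .inr (.inl R) => Sym.out R
      | .inr (.inr R) => Sym.aux R)
    (fun s => match s with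
      | .inp R => ⟨.inl R, rfl⟩
      | .out R => ⟨.inr (.inl R), rfl⟩
      | .aux R => ⟨.inr (.inr R), rfl⟩)

/-- The disjoint union of an input, an output and an auxiliary schema. -/
def fullSchema (In Out Aux : Schema) : Schema where
  Rel := Sym In Out Aux
  finite_rel := Sym.finite In Out Aux
  arity := Sym.arity

/-- A Datalog rule `R₀(x₀) :- R₁(x₁), …, Rₙ(xₙ)` with variables from `V`: the head relation
is an output or auxiliary relation, the body relations are input or auxiliary relations,
and every variable of the head occurs in the body. -/
structure Rule (In Out Aux : Schema) (V : Type) where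
  head : Fact (fullSchema In Out Aux) V
  body : Finset (Fact (fullSchema In Out Aux) V)
  head_rel : ∀ R : In.Rel, head.rel ≠ Sym.inp R
  body_rel : ∀ a ∈ body, ∀ R : Out.Rel, a.rel ≠ Sym.out R
  safe : ∀ x ∈ Set.range head.args, ∃ a ∈ body, x ∈ Set.range a.args

/-- A Datalog program with input schema `In` and output schema `Out`: an auxiliary schema,
a set of variables, and a finite set of rules. -/
structure Program (In Out : Schema) where
  Aux : Schema
  Var : Type
  rules : Set (Rule In Out Aux Var)
  finite_rules : rules.Finite

namespace Program

variable {In Out : Schema}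

/-- One round of the chase: add all facts derivable by a single application of a rule. -/
def chaseStep (P : Program In Out) {D : Type*} (J : Set (Fact (fullSchema In Out P.Aux) D)) :
    Set (Fact (fullSchema In Out P.Aux) D) :=
  J ∪ {f | ∃ ρ ∈ P.rules, ∃ ν : P.Var → D, (∀ a ∈ ρ.body, a.map ν ∈ J) ∧ f = ρ.head.map ν}

/-- The input instance `I`, seen as an instance of the full schema. -/
def embedInput (P : Program In Out) {D : Type*} (I : Set (Fact In D)) :
    Set (Fact (fullSchema In Out P.Aux) D) :=
  (fun f : Fact In D => (⟨Sym.inp f.rel, f.args⟩ : Fact (fullSchema In Out P.Aux) D)) '' I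

/-- The chase of `I`: the union of the stages obtained by iterating `chaseStep` from `I`. -/
def chase (P : Program In Out) {D : Type*} (I : Set (Fact In D)) :
    Set (Fact (fullSchema In Out P.Aux) D) :=
  ⋃ n : ℕ, P.chaseStep^[n] (P.embedInput I)

/-- `P(I)`: the reduct of the chase of `I` to the output schema. -/
def eval (P : Program In Out) {D : Type*} (I : Set (Fact In D)) : Set (Fact Out D) :=
  {f | (⟨Sym.out f.rel, f.args⟩ : Fact (fullSchema In Out P.Aux) D) ∈ P.chase I}

/-- `P` is tree-shaped: the incidence graph of each rule body is acyclic. -/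
def IsTreeShaped (P : Program In Out) : Prop :=
  ∀ ρ ∈ P.rules, IsAcyclic (ρ.body : Set (Fact (fullSchema In Out P.Aux) P.Var))

/-- An articulation function: a partial choice of an argument position for each
auxiliary relation. -/
abbrev ArticulationFunction (P : Program In Out) : Type :=
  (R : P.Aux.Rel) → Option (Fin (P.Aux.arity R))

/-- `x` occurs in the body of `ρ` in a non-articulation position of an auxiliary relation. -/
def OccursNonArticulation (P : Program In Out) (art : P.ArticulationFunction)
    (ρ : Rule In Out P.Aux P.Var) (x : P.Var) : Prop :=
  ∃ (R : P.Aux.Rel) (t : Fin (P.Aux.arity R) → P.Var) (i : Fin (P.Aux.arity R)),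
    (⟨Sym.aux R, t⟩ : Fact (fullSchema In Out P.Aux) P.Var) ∈ ρ.body ∧ art R ≠ some i ∧ t i = x

/-- The head of `ρ` is an auxiliary atom with `x` in its articulation position. -/
def IsHeadArticulation (P : Program In Out) (art : P.ArticulationFunction)
    (ρ : Rule In Out P.Aux P.Var) (x : P.Var) : Prop :=
  ∃ (R : P.Aux.Rel) (t : Fin (P.Aux.arity R) → P.Var) (i : Fin (P.Aux.arity R)),
    ρ.head = ⟨Sym.aux R, t⟩ ∧ art R = some i ∧ t i = x

/-- `P` is almost monadic: for some articulation function, in every rule, each variable in a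
non-articulation position of an auxiliary body atom occurs only once in the
body and is not in the articulation position of an auxiliary head. -/
def IsAlmostMonadic (P : Program In Out) : Prop :=
  ∃ art : P.ArticulationFunction, ∀ ρ ∈ P.rules, ∀ x : P.Var,
    P.OccursNonArticulation art ρ x →
      (occurrences (ρ.body : Set (Fact (fullSchema In Out P.Aux) P.Var)) x).Subsingleton ∧
      ¬ P.IsHeadArticulation art ρ x

/-- TAM Datalog programs: tree-shaped and almost monadic. -/
def IsTAM (P : Program In Out) : Prop :=
  P.IsTreeShaped ∧ P.IsAlmostMonadic

end Program

end Datalog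

/-! Composition is proved through a semantic characterisation of TAM queries that is visibly closed
under composition: having finite duals (`HasFiniteDuals`). For every finite set of colours and every
target `T` on colours there are finitely many structures on finitely many labels, each label
carrying a colour, such that a colouring that maps `Q I` into `T` lifts to a homomorphism from `I`
to some dual, and arc consistency of `I` with a dual implies arc consistency of `Q I` with `T`.
Composing two such queries only requires using the labels for the second as colours for the first
(`HasFiniteDuals.comp`).

A TAM program has finite duals (`Program.IsTAM.hasFiniteDuals`). Its duals are the input parts of
models of the program on neighbourhood types. The chase has a quotient that is such a model:
articulation positions remember the type, payload positions only the colour, and facts are glued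
along the acyclic rule body, losing one level of type per atom. Arc consistency passes from the
input to the chase because bodies are acyclic. Both arguments rest on `IsAcyclic.exists_solution`,
which removes ears one at a time.

Conversely, a query with finite duals that creates no values is computed by a TAM program
(`HasFiniteDuals.exists_isTAM`). Colours are sets of marks, one mark per position of an output
relation, so `R(a)` is an answer iff no dual for `R` admits a homomorphism from `I` that marks every
`a i` with `i`. Such a failure is witnessed by finite tree unravellings of `I`. The program walks
along these trees, keeping at the articulation position the possible labels of the current value and
carrying the marked values as payload. -/

namespace Datalog

open SimpleGraph

/-! ### Ears and partial solutions in acyclic sets of facts -/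

section Acyclicity

/-- A graph is acyclic if its vertices can be ranked so that adjacent vertices have different
ranks and every vertex has at most one neighbour of smaller rank. -/
theorem isAcyclic_of_rank {V : Type*} {G : SimpleGraph V} (r : V → ℕ)
    (hne : ∀ u v, G.Adj u v → r u ≠ r v)
    (huniq : ∀ u v w, G.Adj u v → G.Adj u w → r v < r u → r w < r u → v = w) :
    G.IsAcyclic := by
  classical
  intro v c hc
  -- A vertex of maximal rank on the cycle has two distinct neighbours there, both of smaller rank.
  obtain ⟨u, hu, hmax⟩ := c.support.toFinset.exists_max_image r ⟨v, by simp⟩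
  rw [List.mem_toFinset] at hu
  have hc' := hc.rotate hu
  have hnil := hc'.not_nil
  have h₁ : G.Adj u (c.rotate u hu).snd := (c.rotate u hu).adj_snd hnil
  have h₂ : G.Adj u (c.rotate u hu).penultimate := ((c.rotate u hu).adj_penultimate hnil).symm
  have mem : ∀ w, w ∈ (c.rotate u hu).support → r w ≤ r u := fun w hw =>
    hmax w (by simpa using (c.mem_support_rotate_iff u hu).1 hw)
  refine hc'.snd_ne_penultimate (huniq u _ _ h₁ h₂ ?_ ?_)
  · exact lt_of_le_of_ne (mem _ (Walk.getVert_mem_support _ _)) (hne _ _ h₁).symm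
  · exact lt_of_le_of_ne (mem _ (Walk.getVert_mem_support _ _)) (hne _ _ h₂).symm

variable {S : Schema} {V : Type*}

theorem incidenceGraph_adj_inl_inr {X : Set (Fact S V)} {x : V} {f : Fact S V} :
    (incidenceGraph X).Adj (Sum.inl x) (Sum.inr f) ↔ f ∈ X ∧ x ∈ Set.range f.args := by
  simp [incidenceGraph, SimpleGraph.fromRel_adj]

theorem incidenceGraph_adj_inr_inl {X : Set (Fact S V)} {x : V} {f : Fact S V} :
    (incidenceGraph X).Adj (Sum.inr f) (Sum.inl x) ↔ f ∈ X ∧ x ∈ Set.range f.args := by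
  rw [SimpleGraph.adj_comm, incidenceGraph_adj_inl_inr]

theorem not_incidenceGraph_adj_inl_inl {X : Set (Fact S V)} {x y : V} :
    ¬ (incidenceGraph X).Adj (Sum.inl x) (Sum.inl y) := by
  simp [incidenceGraph, SimpleGraph.fromRel_adj]

theorem not_incidenceGraph_adj_inr_inr {X : Set (Fact S V)} {f g : Fact S V} :
    ¬ (incidenceGraph X).Adj (Sum.inr f) (Sum.inr g) := by
  simp [incidenceGraph, SimpleGraph.fromRel_adj]

theorem IsAcyclic.mono {X Y : Set (Fact S V)} (hXY : X ⊆ Y) (h : IsAcyclic Y) : IsAcyclic X := by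
  refine ⟨fun f hf => h.1 f (hXY hf), h.2.anti ?_⟩
  rintro (x | f) (y | g) hadj
  · exact absurd hadj not_incidenceGraph_adj_inl_inl
  · rw [incidenceGraph_adj_inl_inr] at hadj ⊢
    exact ⟨hXY hadj.1, hadj.2⟩
  · rw [incidenceGraph_adj_inr_inl] at hadj ⊢
    exact ⟨hXY hadj.1, hadj.2⟩
  · exact absurd hadj not_incidenceGraph_adj_inr_inr

/-- The value `x` is in the set `root` or occurs in a fact of `X` other than `a`. -/
def IsLinked (X : Set (Fact S V)) (root : Set V) (a : Fact S V) (x : V) : Prop :=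
  x ∈ root ∨ ∃ b ∈ X, b ≠ a ∧ x ∈ Set.range b.args

/-- A path visits only facts of `X` and values occurring in them, each at most once. The bound makes
the growing paths of `IsAcyclic.exists_ear` impossible. -/
theorem length_lt_of_isPath {X : Finset (Fact S V)} {s : V ⊕ Fact S V} {a : Fact S V}
    (ha : a ∈ X) (p : (incidenceGraph (X : Set (Fact S V))).Walk s (Sum.inr a)) (hp : p.IsPath) :
    p.length < (({x | ∃ f ∈ X, x ∈ Set.range f.args} : Set V).ncard + X.card) := by
  classical
  have hfin : ({x | ∃ f ∈ X, x ∈ Set.range f.args} : Set V).Finite := by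
    have : ({x | ∃ f ∈ X, x ∈ Set.range f.args} : Set V) = ⋃ f ∈ X, Set.range f.args := by
      ext; simp
    rw [this]
    exact X.finite_toSet.biUnion fun f _ => Set.finite_range _
  have hsub : p.support.toFinset ⊆ hfin.toFinset.disjSum X := by
    intro w hw
    rw [List.mem_toFinset] at hw
    by_cases hnil : p.Nil
    · cases hnil
      simp only [Walk.support_nil, List.mem_singleton] at hw
      subst hw
      simpa using ha
    · obtain ⟨w', hw'⟩ : ∃ w', (incidenceGraph (X : Set (Fact S V))).Adj w w' := by
        by_cases hend : w = Sum.inr a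
        · subst hend
          exact ⟨_, (p.adj_penultimate hnil).symm⟩
        · have h := (p.dropUntil w hw).adj_snd (Walk.not_nil_of_ne hend)
          exact ⟨_, h⟩
      rcases w with x | f <;> rcases w' with y | g
      · exact absurd hw' not_incidenceGraph_adj_inl_inl
      · rw [incidenceGraph_adj_inl_inr] at hw'
        simp only [Finset.inl_mem_disjSum, Set.Finite.mem_toFinset]
        exact ⟨g, hw'⟩
      · rw [incidenceGraph_adj_inr_inl] at hw'
        simpa using hw'.1
      · exact absurd hw' not_incidenceGraph_adj_inr_inr
  have := Finset.card_le_card hsub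
  rw [List.toFinset_card_of_nodup hp.support_nodup, Walk.length_support, Finset.card_disjSum,
    ← Set.ncard_eq_toFinset_card _ hfin] at this
  omega

/-- A nonempty finite acyclic set of facts contains a fact with at most one value that is the
root or shared with another fact. -/
theorem IsAcyclic.exists_ear {X : Finset (Fact S V)} (hX : IsAcyclic (X : Set (Fact S V)))
    (hne : X.Nonempty) {root : Set V} (hroot : root.Subsingleton) :
    ∃ a ∈ X, ∀ x ∈ Set.range a.args, ∀ y ∈ Set.range a.args,
      IsLinked (X : Set (Fact S V)) root a x → IsLinked (X : Set (Fact S V)) root a y → x = y := by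
  by_contra hcon
  push Not at hcon
  -- The path starts at the root value if that occurs in `X`. A linked value off the path is then
  -- never the root, hence lies in another fact, and the path can be prolonged.
  obtain ⟨s, hs, a₀, ha₀, ⟨p₀, hp₀⟩⟩ : ∃ s : V ⊕ Fact S V,
      (∀ v ∈ root, ∀ a ∈ X, v ∈ Set.range a.args → s = Sum.inl v) ∧ ∃ a ∈ X,
        ∃ p : (incidenceGraph (X : Set (Fact S V))).Walk s (Sum.inr a), p.IsPath := by
    by_cases h : ∃ v ∈ root, ∃ a ∈ X, v ∈ Set.range a.args
    · obtain ⟨v, hv, a, ha, hva⟩ := h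
      have hadj : (incidenceGraph (X : Set (Fact S V))).Adj (Sum.inl v) (Sum.inr a) :=
        incidenceGraph_adj_inl_inr.2 ⟨ha, hva⟩
      exact ⟨Sum.inl v, fun v' hv' _ _ _ => by rw [hroot hv hv'], a, ha, hadj.toWalk,
        by simp [hadj.ne]⟩
    · push Not at h
      obtain ⟨a, ha⟩ := hne
      exact ⟨Sum.inr a, fun v hv b hb hvb => absurd hvb (h v hv b hb), a, ha, .nil, .nil⟩
  have key : ∀ n : ℕ, ∃ a ∈ X, ∃ p : (incidenceGraph (X : Set (Fact S V))).Walk s (Sum.inr a),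
      p.IsPath ∧ n ≤ p.length := by
    intro n
    induction n with
    | zero => exact ⟨a₀, ha₀, p₀, hp₀, by simp⟩
    | succ n ih =>
      obtain ⟨a, ha, p, hp, hn⟩ := ih
      obtain ⟨y, hya, hy, hyp⟩ : ∃ y ∈ Set.range a.args,
          IsLinked (X : Set (Fact S V)) root a y ∧ Sum.inl y ≠ p.penultimate := by
        obtain ⟨x, hx, y, hy, hlx, hly, hxy⟩ := hcon a ha
        by_cases h : Sum.inl x = p.penultimate
        · exact ⟨y, hy, hly, fun h' => hxy (Sum.inl_injective (h.trans h'.symm))⟩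
        · exact ⟨x, hx, hlx, h⟩
      have hadj : (incidenceGraph (X : Set (Fact S V))).Adj (Sum.inr a) (Sum.inl y) :=
        incidenceGraph_adj_inr_inl.2 ⟨ha, hya⟩
      -- In an acyclic graph, a neighbour of the end of a path that lies on the path is the
      -- penultimate vertex.
      have hy' : Sum.inl y ∉ p.support := fun h =>
        hyp (hX.2.eq_penultimate_of_adj_end hp hadj h)
      rcases hy with hyr | ⟨b, hb, hba, hyb⟩
      · have := hs y hyr a ha hya
        subst this
        exact absurd p.start_mem_support hy'
      · have hq := hp.concat hy' hadj
        have hadj' : (incidenceGraph (X : Set (Fact S V))).Adj (Sum.inl y) (Sum.inr b) :=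
          incidenceGraph_adj_inl_inr.2 ⟨hb, hyb⟩
        have hb' : Sum.inr b ∉ (p.concat hadj).support := fun h => by
          have := hX.2.eq_penultimate_of_adj_end hq hadj' h
          rw [Walk.penultimate_concat] at this
          exact hba (Sum.inr_injective this)
        refine ⟨b, hb, _, hq.concat hb' hadj', ?_⟩
        simp only [Walk.length_concat]
        omega
  obtain ⟨a, ha, p, hp, hn⟩ := key _
  exact absurd (length_lt_of_isPath ha p hp) (not_lt.2 hn)

/-- Extension of partial solutions along an acyclic set of atoms.  The conditions `C k` get
weaker as `k` decreases; each atom can be solved on its own, and any admissible value of a linked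
variable extends to a solution of the atom at the cost of one level. -/
theorem IsAcyclic.exists_solution {W : Type*} {X : Finset (Fact S V)}
    (hX : IsAcyclic (X : Set (Fact S V))) {root : Set V} (hroot : root.Subsingleton)
    (C : ℕ → V → W → Prop) (hC : ∀ k u c, C (k + 1) u c → C k u c)
    (M : Set (Fact S W)) (N : ℕ)
    (hatom : ∀ a ∈ X, ∃ t : Fin (S.arity a.rel) → W, (⟨a.rel, t⟩ : Fact S W) ∈ M ∧
      ∀ j, C N (a.args j) (t j))
    (hext : ∀ a ∈ X, ∀ i, IsLinked (X : Set (Fact S V)) root a (a.args i) →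
      ∀ k < N, ∀ c, C (k + 1) (a.args i) c →
        ∃ t : Fin (S.arity a.rel) → W, (⟨a.rel, t⟩ : Fact S W) ∈ M ∧ t i = c ∧
          ∀ j, C k (a.args j) (t j))
    (k : ℕ) (hk : k + X.card ≤ N) (ν₀ : V → W) (hν₀ : ∀ u, C (k + X.card) u (ν₀ u)) :
    ∃ ν : V → W, (∀ u, C k u (ν u)) ∧ (∀ u ∈ root, ν u = ν₀ u) ∧ ∀ a ∈ X, a.map ν ∈ M := by
  classical
  induction hn : X.card generalizing X k with
  | zero =>
    obtain rfl := Finset.card_eq_zero.1 hn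
    exact ⟨ν₀, by simpa using hν₀, fun _ _ => rfl, by simp⟩
  | succ n ih =>
    have hanti : ∀ k' k, k ≤ k' → ∀ u c, C k' u c → C k u c := by
      intro k' k hkk'
      induction hkk' with
      | refl => exact fun _ _ h => h
      | step _ ih => exact fun u c h => ih u c (hC _ u c h)
    obtain ⟨a, ha, hear⟩ := hX.exists_ear (Finset.card_pos.1 (by omega)) hroot
    have hcard : (X.erase a).card = n := by rw [Finset.card_erase_of_mem ha, hn]; rfl
    have hsub : ((X.erase a : Finset (Fact S V)) : Set (Fact S V)) ⊆ X := by
      exact_mod_cast X.erase_subset a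
    -- The atoms other than the ear are solved one level higher. That solution and the root then
    -- prescribe a value for at most one variable of the ear, and extending it costs the spare
    -- level.
    obtain ⟨ν, hν, hνroot, hνX⟩ := ih (X := X.erase a) (hX.mono hsub)
      (fun b hb => hatom b (hsub hb))
      (fun b hb i hi => hext b (hsub hb) i
        (hi.imp id fun ⟨d, hd, hdb, hx⟩ => ⟨d, hsub hd, hdb, hx⟩))
      (k + 1) (by omega) (fun u => hanti _ _ (by omega) _ _ (hν₀ u)) hcard
    obtain ⟨t, htM, htν, htC⟩ : ∃ t : Fin (S.arity a.rel) → W, (⟨a.rel, t⟩ : Fact S W) ∈ M ∧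
        (∀ j, IsLinked (X : Set (Fact S V)) root a (a.args j) → t j = ν (a.args j)) ∧
        ∀ j, C k (a.args j) (t j) := by
      by_cases h : ∃ i, IsLinked (X : Set (Fact S V)) root a (a.args i)
      · obtain ⟨i, hi⟩ := h
        obtain ⟨t, htM, hti, htC⟩ := hext a ha i hi k (by omega) (ν (a.args i)) (hν _)
        refine ⟨t, htM, fun j hj => ?_, htC⟩
        have := hX.1 a ha (hear _ ⟨j, rfl⟩ _ ⟨i, rfl⟩ hj hi)
        subst this
        exact hti
      · push Not at h
        obtain ⟨t, htM, htC⟩ := hatom a ha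
        exact ⟨t, htM, fun j hj => absurd hj (h j), fun j => hanti N k (by omega) _ _ (htC j)⟩
    -- Unlinked variables of the ear occur in no other atom and are not the root, so they can be
    -- reassigned freely.
    let ν' : V → W := fun u =>
      if h : (∃ j, a.args j = u) ∧ ¬ IsLinked (X : Set (Fact S V)) root a u then t h.1.choose
      else ν u
    have hlinked : ∀ u, IsLinked (X : Set (Fact S V)) root a u → ν' u = ν u := fun u hu =>
      dif_neg fun h => h.2 hu
    have hargs : ∀ j, ν' (a.args j) = t j := by
      intro j
      by_cases hj : IsLinked (X : Set (Fact S V)) root a (a.args j)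
      · rw [hlinked _ hj, htν j hj]
      · have h : (∃ j', a.args j' = a.args j) ∧
          ¬ IsLinked (X : Set (Fact S V)) root a (a.args j) := ⟨⟨j, rfl⟩, hj⟩
        simp only [ν', dif_pos h]
        rw [hX.1 a ha h.1.choose_spec]
    refine ⟨ν', fun u => ?_, fun u hu => ?_, fun b hb => ?_⟩
    · by_cases h : ∃ j, a.args j = u
      · obtain ⟨j, rfl⟩ := h
        rw [hargs]
        exact htC j
      · have : ν' u = ν u := dif_neg fun h' => h h'.1
        rw [this]
        exact hC _ _ _ (hν u)
    · rw [hlinked u (Or.inl hu), hνroot u hu]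
    · by_cases hba : b = a
      · subst hba
        have : b.map ν' = ⟨b.rel, t⟩ := by
          simp only [Fact.map, Fact.mk.injEq, heq_eq_eq, true_and]
          exact funext hargs
        rwa [this]
      · have : b.map ν' = b.map ν := by
          simp only [Fact.map, Fact.mk.injEq, heq_eq_eq, true_and]
          exact funext fun j => hlinked _ (Or.inr ⟨b, hb, hba, j, rfl⟩)
        rw [this]
        exact hνX b (Finset.mem_erase.2 ⟨hba, hb⟩)

end Acyclicity

end Datalog

namespace Datalog

/-! ### The chase as the least model -/

section Chase

variable {In Out : Schema}

/-- A set of facts over the full schema that is closed under the rules of the program. -/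
def Program.IsModel (P : Program In Out) {D : Type*}
    (M : Set (Fact (fullSchema In Out P.Aux) D)) : Prop :=
  ∀ ρ ∈ P.rules, ∀ ν : P.Var → D, (∀ a ∈ ρ.body, a.map ν ∈ M) → ρ.head.map ν ∈ M

variable (P : Program In Out) {D : Type*} (I : Set (Fact In D))

theorem Program.embedInput_subset_chase : P.embedInput I ⊆ P.chase I := fun _ hf =>
  Set.mem_iUnion.2 ⟨0, hf⟩

theorem Program.monotone_chase_stages :
    Monotone fun n : ℕ => P.chaseStep^[n] (P.embedInput I) :=
  monotone_nat_of_le_succ fun n => by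
    rw [Function.iterate_succ_apply']
    exact Set.subset_union_left

theorem Program.isModel_chase : P.IsModel (P.chase I) := by
  intro ρ hρ ν hbody
  have : ∃ n, ∀ a ∈ ρ.body, a.map ν ∈ P.chaseStep^[n] (P.embedInput I) := by
    have h : ∀ a ∈ ρ.body, ∃ n, a.map ν ∈ P.chaseStep^[n] (P.embedInput I) := fun a ha =>
      Set.mem_iUnion.1 (hbody a ha)
    choose! n hn using h
    exact ⟨ρ.body.sup n, fun a ha =>
      P.monotone_chase_stages I (Finset.le_sup (f := n) ha) (hn a ha)⟩
  obtain ⟨n, hn⟩ := this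
  refine Set.mem_iUnion.2 ⟨n + 1, ?_⟩
  rw [Function.iterate_succ_apply']
  exact Or.inr ⟨ρ, hρ, ν, hn, rfl⟩

variable {P I}

theorem Program.IsModel.chase_subset {M : Set (Fact (fullSchema In Out P.Aux) D)}
    (hM : P.IsModel M) (hI : P.embedInput I ⊆ M) : P.chase I ⊆ M := by
  refine Set.iUnion_subset fun n => ?_
  induction n with
  | zero => exact hI
  | succ n ih =>
    rw [Function.iterate_succ_apply']
    rintro f (hf | ⟨ρ, hρ, ν, hbody, rfl⟩)
    · exact ih hf
    · exact hM ρ hρ ν fun a ha => ih (hbody a ha)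

theorem Program.inp_mem_chase {f : Fact In D} (hf : f ∈ I) :
    (⟨Sym.inp f.rel, f.args⟩ : Fact (fullSchema In Out P.Aux) D) ∈ P.chase I :=
  P.embedInput_subset_chase I ⟨f, hf, rfl⟩

/-- The values occurring in a set of facts. -/
def activeDomain {S : Schema} {D : Type*} (I : Set (Fact S D)) : Set D :=
  {x | ∃ f ∈ I, x ∈ Set.range f.args}

theorem Program.activeDomain_eval_subset : activeDomain (P.eval I) ⊆ activeDomain I := by
  have hM : P.IsModel {f : Fact (fullSchema In Out P.Aux) D |
      ∀ i, f.args i ∈ activeDomain I} := by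
    intro ρ hρ ν hbody i
    obtain ⟨a, ha, j, hj⟩ := ρ.safe (ρ.head.args i) ⟨i, rfl⟩
    have : ν (a.args j) ∈ activeDomain I := hbody a ha j
    rw [hj] at this
    exact this
  have hI : P.embedInput I ⊆ {f : Fact (fullSchema In Out P.Aux) D |
      ∀ i, f.args i ∈ activeDomain I} := by
    rintro _ ⟨f, hf, rfl⟩ i
    exact ⟨f, hf, i, rfl⟩
  rintro x ⟨f, hf, i, rfl⟩
  exact hM.chase_subset hI hf i

end Chase

/-! ### Tree-shaped programs preserve arc consistency -/

section ArcConsistency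

variable {S : Schema} {D Λ : Type*}

/-- Every choice of a label at one argument of `f`, among the labels admitted by `g`, extends to
a fact of `B` labelled within `g`. -/
def ArcConsistent (B : Set (Fact S Λ)) (g : D → Set Λ) (f : Fact S D) : Prop :=
  (∃ t : Fin (S.arity f.rel) → Λ, (⟨f.rel, t⟩ : Fact S Λ) ∈ B ∧ ∀ j, t j ∈ g (f.args j)) ∧
  ∀ i, ∀ l ∈ g (f.args i), ∃ t : Fin (S.arity f.rel) → Λ,
    (⟨f.rel, t⟩ : Fact S Λ) ∈ B ∧ t i = l ∧ ∀ j, t j ∈ g (f.args j)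

theorem arcConsistent_singleton {B : Set (Fact S Λ)} {g : D → Λ} {f : Fact S D}
    (h : f.map g ∈ B) : ArcConsistent B (fun x => {g x}) f :=
  ⟨⟨_, h, fun _ => rfl⟩, fun _ _ hl => ⟨_, h, hl.symm, fun _ => rfl⟩⟩

variable {In Out : Schema} {P : Program In Out}

/-- An arc consistent atom extends any admissible label of one argument, so along an acyclic body a
label prescribed at one head variable extends to a solution in `M`. Hence the arc consistent facts
are closed under the rules. -/
theorem Program.IsTreeShaped.arcConsistent_chase (hP : P.IsTreeShaped)
    {M : Set (Fact (fullSchema In Out P.Aux) Λ)} (hM : P.IsModel M)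
    {I : Set (Fact In D)} {g : D → Set Λ} (hg : ∀ x, (g x).Nonempty)
    (hI : ∀ f ∈ I, ArcConsistent {f : Fact In Λ | ⟨Sym.inp f.rel, f.args⟩ ∈ M} g f) :
    ∀ f ∈ P.chase I, ArcConsistent M g f := by
  have hmodel : P.IsModel {f : Fact (fullSchema In Out P.Aux) D | ArcConsistent M g f} := by
    intro ρ hρ ν hbody
    have key : ∀ (root : Set P.Var) (_ : root.Subsingleton) (ν₀ : P.Var → Λ),
        (∀ u, ν₀ u ∈ g (ν u)) → ∃ ν' : P.Var → Λ, ρ.head.map ν' ∈ M ∧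
          (∀ u, ν' u ∈ g (ν u)) ∧ ∀ u ∈ root, ν' u = ν₀ u := by
      intro root hroot ν₀ hν₀
      -- The condition is the same at all levels, so the number of levels is immaterial.
      obtain ⟨ν', h₁, h₂, h₃⟩ := (hP ρ hρ).exists_solution hroot
        (fun _ u c => c ∈ g (ν u)) (fun _ _ _ h => h) M ρ.body.card
        (fun a ha => (hbody a ha).1)
        (fun a ha i _ _ _ c hc => (hbody a ha).2 i c hc) 0 (by simp) ν₀ hν₀
      exact ⟨ν', hM ρ hρ ν' h₃, h₁, h₂⟩
    choose ν₀ hν₀ using fun u => hg (ν u)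
    constructor
    · obtain ⟨ν', h, hν', -⟩ := key ∅ Set.subsingleton_empty ν₀ hν₀
      exact ⟨_, h, fun j => hν' _⟩
    · intro i l hl
      classical
      obtain ⟨ν', h, hν', hr⟩ := key {ρ.head.args i} Set.subsingleton_singleton
        (Function.update ν₀ (ρ.head.args i) l) (by
          intro u
          by_cases hu : u = ρ.head.args i
          · subst hu
            rw [Function.update_self]
            exact hl
          · simpa [Function.update_of_ne hu] using hν₀ u)
      exact ⟨_, h, (hr _ rfl).trans (Function.update_self ..), fun j => hν' _⟩
  refine hmodel.chase_subset ?_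
  rintro _ ⟨f, hf, rfl⟩
  exact hI f hf

end ArcConsistency

/-! ### Neighbourhood types -/

section Types

variable {S : Schema}

/-- Neighbourhood types of depth `n` over a set `J` of colours. -/
def NbhdType (S : Schema) (J : Type) : ℕ → Type
  | 0 => J
  | n + 1 => NbhdType S J n ×
      Set (Σ R : S.Rel, Fin (S.arity R) × (Fin (S.arity R) → NbhdType S J n))

theorem NbhdType.finite (S : Schema) (J : Type) [Finite J] (n : ℕ) : Finite (NbhdType S J n) := by
  induction n with
  | zero => assumption
  | succ n ih => unfold NbhdType; infer_instance

/-- The colour recorded in a neighbourhood type. -/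
def NbhdType.colour {J : Type} : (n : ℕ) → NbhdType S J n → J
  | 0, t => t
  | n + 1, t => NbhdType.colour n t.1

variable {J : Type} {D : Type*} (M : Set (Fact S D)) (h : D → J)

/-- The neighbourhood type of depth `n` of a value in an instance coloured by `h`. -/
def nbhdType : (n : ℕ) → D → NbhdType S J n
  | 0, x => h x
  | n + 1, x => (nbhdType n x, {o | ∃ t : Fin (S.arity o.1) → D,
      (⟨o.1, t⟩ : Fact S D) ∈ M ∧ t o.2.1 = x ∧ (fun j => nbhdType n (t j)) = o.2.2})

@[simp]
theorem colour_nbhdType (n : ℕ) (x : D) : (nbhdType M h n x).colour n = h x := by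
  induction n with
  | zero => rfl
  | succ n ih => exact ih

variable {M h}

theorem nbhdType_eq_of_le {m n : ℕ} (hmn : m ≤ n) {x y : D}
    (hxy : nbhdType M h n x = nbhdType M h n y) : nbhdType M h m x = nbhdType M h m y := by
  induction hmn with
  | refl => exact hxy
  | step _ ih => exact ih (congrArg Prod.fst hxy)

/-- A type of depth `n + 1` records the facts through a value together with the depth `n` types of
their arguments. This is the extension step that costs one level. -/
theorem exists_fact_of_nbhdType_eq {n : ℕ} {R : S.Rel} {t : Fin (S.arity R) → D}
    (ht : (⟨R, t⟩ : Fact S D) ∈ M) (i : Fin (S.arity R)) {y : D}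
    (hy : nbhdType M h (n + 1) y = nbhdType M h (n + 1) (t i)) :
    ∃ t' : Fin (S.arity R) → D, (⟨R, t'⟩ : Fact S D) ∈ M ∧ t' i = y ∧
      ∀ j, nbhdType M h n (t' j) = nbhdType M h n (t j) := by
  have hmem : (⟨R, i, fun j => nbhdType M h n (t j)⟩ :
      Σ R : S.Rel, Fin (S.arity R) × (Fin (S.arity R) → NbhdType S J n)) ∈
      (nbhdType M h (n + 1) (t i)).2 := ⟨t, ht, rfl, rfl⟩
  rw [← hy] at hmem
  obtain ⟨t', ht', hi, hj⟩ := hmem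
  exact ⟨t', ht', hi, fun j => congrFun hj j⟩

end Types

/-! ### The type quotient of the chase is a model -/

section Quotient

variable {In Out : Schema} (P : Program In Out) (art : P.ArticulationFunction)

/-- The positions of a relation at which the type quotient of the chase records the full type:
all positions of input relations and the articulation positions. -/
def IsExact : (s : (fullSchema In Out P.Aux).Rel) → Fin ((fullSchema In Out P.Aux).arity s) → Prop
  | .inp _, _ => True
  | .out _, _ => False
  | .aux R, i => art R = some i

variable {J : Type} {D : Type*} (I : Set (Fact In D)) (h : D → J) (N : ℕ)

/-- The quotient of the chase by types of depth `N`, in which positions that are not exact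
only record colours. -/
def typeQuotient : Set (Fact (fullSchema In Out P.Aux) (NbhdType (fullSchema In Out P.Aux) J N)) :=
  {f | ∃ t : Fin ((fullSchema In Out P.Aux).arity f.rel) → D,
    (⟨f.rel, t⟩ : Fact (fullSchema In Out P.Aux) D) ∈ P.chase I ∧
    (∀ i, h (t i) = (f.args i).colour N) ∧
    ∀ i, IsExact P art f.rel i → nbhdType (P.chase I) h N (t i) = f.args i}

variable {P art I h N}

/-- Each body atom has a preimage in the chase, but the preimages need not agree on shared
variables. Almost monadicity says that shared variables and the head articulation variable are not
payload, so there the preimages agree up to types of depth `N`. Gluing along the body loses at most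
`N` levels and so keeps all colours. The articulation variable of the head is the root of the
gluing, so it keeps its full type. -/
theorem isModel_typeQuotient [Nonempty D] (hP : P.IsTreeShaped)
    (hart : ∀ ρ ∈ P.rules, ∀ x : P.Var, P.OccursNonArticulation art ρ x →
      (occurrences (ρ.body : Set (Fact (fullSchema In Out P.Aux) P.Var)) x).Subsingleton ∧
      ¬ P.IsHeadArticulation art ρ x)
    (hN : ∀ ρ ∈ P.rules, ρ.body.card ≤ N) : P.IsModel (typeQuotient P art I h N) := by
  classical
  intro ρ hρ ν hbody
  -- Payload variables: those with an occurrence where the quotient remembers only the colour.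
  set pay : P.Var → Prop := fun u => ∃ a ∈ ρ.body, ∃ i, a.args i = u ∧ ¬ IsExact P art a.rel i
  have hpay' : ∀ u, pay u → P.OccursNonArticulation art ρ u := by
    rintro u ⟨⟨s, t⟩, ha, i, hi, hex⟩
    cases s with
    | inp R => exact absurd trivial hex
    | out R => exact absurd rfl (ρ.body_rel _ ha R)
    | aux R => exact ⟨R, t, i, ha, hex, hi⟩
  set root : Set P.Var := {u | ∃ i, ρ.head.args i = u ∧ IsExact P art ρ.head.rel i}
  have hroot_head : ∀ u ∈ root, P.IsHeadArticulation art ρ u := by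
    have aux : ∀ f : Fact (fullSchema In Out P.Aux) P.Var, ρ.head = f → ∀ i,
        IsExact P art f.rel i → P.IsHeadArticulation art ρ (f.args i) := by
      rintro ⟨s, t⟩ hf i hex
      cases s with
      | inp R => exact absurd (congrArg Fact.rel hf) (ρ.head_rel R)
      | out R => exact absurd hex id
      | aux R => exact ⟨R, t, i, hf, hex, rfl⟩
    rintro u ⟨i, rfl, hex⟩
    exact aux _ rfl i hex
  have hroot : root.Subsingleton := by
    have aux : ∀ s : (fullSchema In Out P.Aux).Rel, (∀ R, s ≠ Sym.inp R) → ∀ i j,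
        IsExact P art s i → IsExact P art s j → i = j := by
      intro s hs i j hi hj
      cases s with
      | inp R => exact absurd rfl (hs R)
      | out R => exact absurd hi id
      | aux R => exact Option.some.inj (Eq.trans (Eq.symm hi) hj)
    rintro _ ⟨i, rfl, hi⟩ _ ⟨j, rfl, hj⟩
    rw [aux _ ρ.head_rel i j hi hj]
  have hlinked : ∀ a ∈ ρ.body, ∀ i,
      IsLinked (ρ.body : Set (Fact (fullSchema In Out P.Aux) P.Var)) root a (a.args i) →
      ¬ pay (a.args i) := by
    rintro a ha i hl hp
    obtain ⟨hsub, hnh⟩ := hart ρ hρ _ (hpay' _ hp)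
    rcases hl with hr | ⟨b, hb, hba, j, hj⟩
    · exact hnh (hroot_head _ hr)
    · have := hsub (show (⟨a, i⟩ : Σ f : Fact (fullSchema In Out P.Aux) P.Var,
          Fin ((fullSchema In Out P.Aux).arity f.rel)) ∈ _ from ⟨ha, rfl⟩)
        (show (⟨b, j⟩ : Σ f : Fact (fullSchema In Out P.Aux) P.Var,
          Fin ((fullSchema In Out P.Aux).arity f.rel)) ∈ _ from ⟨hb, hj⟩)
      exact hba (congrArg Sigma.fst this).symm
  -- A representative value for each body variable, of the prescribed type, or merely of the
  -- prescribed colour if the variable is payload.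
  have hstart : ∀ u, ∃ x : D, (∃ a ∈ ρ.body, u ∈ Set.range a.args) →
      h x = (ν u).colour N ∧ (¬ pay u → nbhdType (P.chase I) h N x = ν u) := by
    intro u
    by_cases hu : ∃ a ∈ ρ.body, u ∈ Set.range a.args
    · obtain ⟨a, ha, i, rfl⟩ := hu
      obtain ⟨t, -, htc, hte⟩ := hbody a ha
      refine ⟨t i, fun _ => ⟨htc i, fun hp => hte i ?_⟩⟩
      by_contra hex
      exact hp ⟨a, ha, i, rfl, hex⟩
    · exact ⟨Classical.arbitrary D, fun h => absurd h hu⟩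
  choose ν₀ hν₀ using hstart
  obtain ⟨ν', h₁, h₂, h₃⟩ := (hP ρ hρ).exists_solution hroot
    (fun k u x => h x = h (ν₀ u) ∧
      (¬ pay u → nbhdType (P.chase I) h k x = nbhdType (P.chase I) h k (ν₀ u)))
    (fun k u c hc => ⟨hc.1, fun hp => nbhdType_eq_of_le (Nat.le_succ k) (hc.2 hp)⟩)
    (P.chase I) N
    (fun a ha => by
      obtain ⟨t, ht, htc, hte⟩ := hbody a ha
      refine ⟨t, ht, fun j => ?_⟩
      have hj := hν₀ (a.args j) ⟨a, ha, j, rfl⟩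
      refine ⟨(htc j).trans hj.1.symm, fun hp => (hte j ?_).trans (hj.2 hp).symm⟩
      by_contra hex
      exact hp ⟨a, ha, j, rfl, hex⟩)
    (fun a ha i hl k hk c hc => by
      obtain ⟨t, ht, htc, hte⟩ := hbody a ha
      have hpi := hlinked a ha i hl
      have hex : ∀ j, ¬ pay (a.args j) →
          nbhdType (P.chase I) h N (t j) = nbhdType (P.chase I) h N (ν₀ (a.args j)) := by
        intro j hp
        refine (hte j ?_).trans ((hν₀ (a.args j) ⟨a, ha, j, rfl⟩).2 hp).symm
        by_contra hex
        exact hp ⟨a, ha, j, rfl, hex⟩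
      obtain ⟨t', ht', hi, hj⟩ := exists_fact_of_nbhdType_eq ht i
        ((hc.2 hpi).trans (nbhdType_eq_of_le (by omega) (hex i hpi)).symm)
      refine ⟨t', ht', hi, fun j => ⟨?_, fun hp => (hj j).trans
        (nbhdType_eq_of_le (by omega) (hex j hp))⟩⟩
      have := congrArg (NbhdType.colour k) (hj j)
      rw [colour_nbhdType, colour_nbhdType] at this
      exact this.trans ((htc j).trans (hν₀ (a.args j) ⟨a, ha, j, rfl⟩).1.symm))
    0 (by simpa using hN ρ hρ) ν₀ (fun u => ⟨rfl, fun _ => rfl⟩)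
  refine ⟨fun i => ν' (ρ.head.args i), P.isModel_chase I ρ hρ ν' h₃, fun i => ?_, fun i hi => ?_⟩
  · exact (h₁ _).1.trans (hν₀ _ (ρ.safe _ ⟨i, rfl⟩)).1
  · have hr : ρ.head.args i ∈ root := ⟨i, rfl, hi⟩
    change nbhdType (P.chase I) h N (ν' (ρ.head.args i)) = ν (ρ.head.args i)
    rw [h₂ _ hr]
    refine (hν₀ _ (ρ.safe _ ⟨i, rfl⟩)).2 fun hp => ?_
    exact (hart ρ hρ _ (hpay' _ hp)).2 (hroot_head _ hr)

end Quotient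

/-! ### Finite duals and their composition -/

section Duality

universe u

/-- A query from `In`-instances to `Out`-instances has finite duals if homomorphisms of its
results into a finite `Out`-structure `T` correspond to homomorphisms of its inputs into a
finite set of finite `In`-structures, in a form compatible with arc consistency. -/
def HasFiniteDuals {In Out : Schema}
    (Q : ∀ {D : Type u}, Set (Fact In D) → Set (Fact Out D)) : Prop :=
  ∀ (J : Type) [Finite J] [Nonempty J], ∃ (Λ : Type) (_ : Finite Λ) (_ : Nonempty Λ) (π : Λ → J),
    ∀ T : Set (Fact Out J), ∃ 𝓑 : Set (Set (Fact In Λ)),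
      (∀ (D : Type u) [Nonempty D] (I : Set (Fact In D)) (h : D → J),
        (∀ f ∈ Q I, f.map h ∈ T) → ∃ B ∈ 𝓑, ∃ g : D → Λ, (∀ x, π (g x) = h x) ∧
          ∀ f ∈ I, f.map g ∈ B) ∧
      ∀ B ∈ 𝓑, ∀ (D : Type u) (I : Set (Fact In D)) (g : D → Set Λ), (∀ x, (g x).Nonempty) →
        (∀ f ∈ I, ArcConsistent B g f) → ∀ f ∈ Q I, ArcConsistent T (fun x => π '' g x) f

/-- The labels for `Q₂` serve as colours for `Q₁`, and each dual for `Q₂` as a target for `Q₁`. This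
is why the definition quantifies over all colour sets and why its second clause concludes with arc
consistency again. -/
theorem HasFiniteDuals.comp {In Mid Out : Schema}
    {Q₁ : ∀ {D : Type u}, Set (Fact In D) → Set (Fact Mid D)}
    {Q₂ : ∀ {D : Type u}, Set (Fact Mid D) → Set (Fact Out D)}
    (h₁ : HasFiniteDuals Q₁) (h₂ : HasFiniteDuals Q₂) :
    HasFiniteDuals fun {_} I => Q₂ (Q₁ I) := by
  intro J _ _
  obtain ⟨Λ₂, _, _, π₂, H₂⟩ := h₂ J
  obtain ⟨Λ₁, _, _, π₁, H₁⟩ := h₁ Λ₂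
  refine ⟨Λ₁, inferInstance, inferInstance, π₂ ∘ π₁, fun T => ?_⟩
  obtain ⟨𝓑₂, hom₂, arc₂⟩ := H₂ T
  choose 𝓑₁ hom₁ arc₁ using H₁
  refine ⟨⋃ B ∈ 𝓑₂, 𝓑₁ B, fun D _ I h hh => ?_, fun B hB D I g hg hI f hf => ?_⟩
  · obtain ⟨B₂, hB₂, g₂, hπ₂, hg₂⟩ := hom₂ D _ h hh
    obtain ⟨B₁, hB₁, g₁, hπ₁, hg₁⟩ := hom₁ B₂ D I g₂ hg₂
    exact ⟨B₁, Set.mem_biUnion hB₂ hB₁, g₁, fun x => by simp [hπ₁, hπ₂], hg₁⟩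
  · obtain ⟨B₂, hB₂, hB⟩ := Set.mem_iUnion₂.1 hB
    have := arc₂ B₂ hB₂ D (Q₁ I) (fun x => π₁ '' g x) (fun x => (hg x).image _)
      (arc₁ B₂ B hB D I g hg hI) f hf
    simpa only [Set.image_comp] using this

/-- Tree-shaped almost monadic programs have finite duals. -/
theorem Program.IsTAM.hasFiniteDuals {In Out : Schema} {P : Program In Out} (hP : P.IsTAM) :
    HasFiniteDuals.{u} fun {_} I => P.eval I := by
  obtain ⟨htree, art, hart⟩ := hP
  intro J _ hJ
  set F := fullSchema In Out P.Aux
  obtain ⟨N, hN⟩ : ∃ N, ∀ ρ ∈ P.rules, ρ.body.card ≤ N := by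
    obtain ⟨N, hN⟩ := (P.finite_rules.image fun ρ => ρ.body.card).bddAbove
    exact ⟨N, fun ρ hρ => hN ⟨ρ, hρ, rfl⟩⟩
  have hne : ∀ n, Nonempty (NbhdType F J n) := fun n =>
    ⟨nbhdType (D := J) ∅ id n hJ.some⟩
  -- The duals are the input parts of models on types whose output facts have colours in `T`. The
  -- type quotient is the model that gives the first clause.
  refine ⟨NbhdType F J N, NbhdType.finite _ _ _, hne N, NbhdType.colour N, fun T =>
    ⟨{B | ∃ M : Set (Fact F (NbhdType F J N)), P.IsModel M ∧
      B = {f : Fact In (NbhdType F J N) | (⟨Sym.inp f.rel, f.args⟩ : Fact F _) ∈ M} ∧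
      ∀ f : Fact Out (NbhdType F J N), (⟨Sym.out f.rel, f.args⟩ : Fact F _) ∈ M →
        f.map (NbhdType.colour N) ∈ T}, ?_, ?_⟩⟩
  · intro D _ I h hh
    refine ⟨_, ⟨typeQuotient P art I h N, isModel_typeQuotient htree hart hN, rfl, ?_⟩,
      nbhdType (P.chase I) h N, fun x => colour_nbhdType _ _ _ _, ?_⟩
    · rintro ⟨R, s⟩ ⟨t, ht, htc, -⟩
      have := hh ⟨R, t⟩ ht
      have hs : (⟨R, t⟩ : Fact Out D).map h =
          (⟨R, s⟩ : Fact Out (NbhdType F J N)).map (NbhdType.colour N) := by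
        simp only [Fact.map, Fact.mk.injEq, heq_eq_eq, true_and]
        exact funext htc
      rwa [← hs]
    · intro f hf
      exact ⟨f.args, Program.inp_mem_chase hf, fun i => (colour_nbhdType _ _ _ _).symm,
        fun i _ => rfl⟩
  · rintro _ ⟨M, hM, rfl, hT⟩ D I g hg hI f hf
    have := htree.arcConsistent_chase hM hg hI _ hf
    refine ⟨?_, ?_⟩
    · obtain ⟨t, ht, htg⟩ := this.1
      exact ⟨_, hT ⟨f.rel, t⟩ ht, fun j => ⟨_, htg j, rfl⟩⟩
    · rintro i _ ⟨l, hl, rfl⟩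
      obtain ⟨t, ht, hti, htg⟩ := this.2 i l hl
      exact ⟨_, hT ⟨f.rel, t⟩ ht, congrArg _ hti, fun j => ⟨_, htg j, rfl⟩⟩

end Duality

end Datalog

namespace Datalog

/-! ### The program built from dual structures -/

section DualProgram

theorem finite_fact (S : Schema) (X : Type*) [Finite X] : Finite (Fact S X) :=
  Finite.of_injective (β := Σ R : S.Rel, Fin (S.arity R) → X) (fun f => ⟨f.rel, f.args⟩)
    (by rintro ⟨R, t⟩ ⟨R', t'⟩ h; cases h; rfl)

/-- For every output relation, a set of dual structures on a finite set of labels, each label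
carrying a set of marks indexed by the positions of the relation. -/
structure DualFamily (In Out : Schema) where
  Label : Type
  [finite_label : Finite Label]
  mark : (R : Out.Rel) → Fin (Out.arity R) → Label → Prop
  duals : Out.Rel → Set (Set (Fact In Label))

attribute [instance] DualFamily.finite_label

namespace DualFamily

variable {In Out : Schema} (Δ : DualFamily In Out)

/-- A state for the output relation `R`: a set of labels for each dual structure, and the set of
marks that have been used. -/
abbrev State (R : Out.Rel) : Type :=
  (Set (Fact In Δ.Label) → Set Δ.Label) × Set (Fin (Out.arity R))

instance finite_state (R : Out.Rel) : Finite (Δ.State R) :=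
  have := finite_fact In Δ.Label
  inferInstance

/-- The auxiliary relations are the states; their arguments are a value and one value for
each mark. -/
def auxSchema : Schema where
  Rel := Σ R : Out.Rel, Δ.State R
  arity s := Out.arity s.1 + 1

/-- Variables: roots `x j`, and payload variables `y j i`. -/
abbrev Var : Type := ℕ ⊕ ℕ × ℕ

/-- The fact stating that `x` is in state `s` with the marks placed at `y`. -/
def stateFact {D : Type*} (R : Out.Rel) (s : Δ.State R) (x : D) (y : Fin (Out.arity R) → D) :
    Fact (fullSchema In Out Δ.auxSchema) D :=
  ⟨Sym.aux ⟨R, s⟩, (Fin.cons x y : Fin (Out.arity R + 1) → D)⟩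

theorem map_stateFact {D E : Type*} (ν : D → E) (R : Out.Rel) (s : Δ.State R) (x : D)
    (y : Fin (Out.arity R) → D) :
    (Δ.stateFact R s x y).map ν = Δ.stateFact R s (ν x) (fun i => ν (y i)) := by
  refine congrArg (fun t => (⟨Sym.aux ⟨R, s⟩, t⟩ : Fact (fullSchema In Out Δ.auxSchema) E))
    (funext fun i : Fin (Out.arity R + 1) => ?_)
  refine Fin.cases ?_ (fun i => ?_) i <;> rfl

/-- The atom of the input relation `E` on the root variables. -/
def inAtom (E : In.Rel) : Fact (fullSchema In Out Δ.auxSchema) Var :=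
  ⟨Sym.inp E, fun j : Fin (In.arity E) => Sum.inl (j : ℕ)⟩

/-- The state atom at the `j`-th root variable, with its own payload variables. -/
def stateAtom (R : Out.Rel) (s : Δ.State R) (j : ℕ) : Fact (fullSchema In Out Δ.auxSchema) Var :=
  Δ.stateFact R s (Sum.inl j) fun i => Sum.inr (j, (i : ℕ))

theorem injective_args_inAtom (E : In.Rel) : Function.Injective (Δ.inAtom E).args :=
  fun _ _ h => Fin.ext (Sum.inl_injective h)

theorem injective_args_stateAtom (R : Out.Rel) (s : Δ.State R) (j : ℕ) :
    Function.Injective (Δ.stateAtom R s j).args := by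
  refine Fin.cons_injective_iff.2 ⟨by simp, fun i i' h => ?_⟩
  exact Fin.ext (Prod.ext_iff.1 (Sum.inr_injective h)).2

theorem inl_of_mem_range_inAtom {E : In.Rel} {x : Var} (hx : x ∈ Set.range (Δ.inAtom E).args) :
    ∃ m, x = Sum.inl m := by
  obtain ⟨i, rfl⟩ := hx
  exact ⟨_, rfl⟩

theorem args_stateAtom_cases {R : Out.Rel} {s : Δ.State R} {j : ℕ}
    (i : Fin (Out.arity R + 1)) :
    (i = 0 ∧ (Δ.stateAtom R s j).args i = Sum.inl j) ∨
      ∃ i', i ≠ 0 ∧ (Δ.stateAtom R s j).args i = Sum.inr (j, i') := by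
  refine Fin.cases (Or.inl ⟨rfl, rfl⟩) (fun i => Or.inr ⟨_, Fin.succ_ne_zero i, rfl⟩) i

theorem mem_range_stateAtom {R : Out.Rel} {s : Δ.State R} {j : ℕ} {x : Var}
    (hx : x ∈ Set.range (Δ.stateAtom R s j).args) :
    x = Sum.inl j ∨ ∃ i, x = Sum.inr (j, i) := by
  obtain ⟨i, rfl⟩ := hx
  rcases Δ.args_stateAtom_cases (s := s) (j := j) i with ⟨-, h⟩ | ⟨i', -, h⟩
  · exact Or.inl h
  · exact Or.inr ⟨i', h⟩

/-- A set of atoms consisting of input atoms without common variables and at most one state atom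
at each root variable. -/
structure IsStar (X : Set (Fact (fullSchema In Out Δ.auxSchema) Var)) : Prop where
  cases : ∀ f ∈ X, (∃ E, f = Δ.inAtom E) ∨ ∃ R s j, f = Δ.stateAtom R s j
  input : ∀ E E', Δ.inAtom E ∈ X → Δ.inAtom E' ∈ X → 0 < In.arity E → 0 < In.arity E' → E = E'
  state : ∀ R s R' s' j, Δ.stateAtom R s j ∈ X → Δ.stateAtom R' s' j ∈ X →
    Δ.stateAtom R s j = Δ.stateAtom R' s' j

variable {Δ} in
theorem IsStar.eq_of_mem_range_inr {X : Set (Fact (fullSchema In Out Δ.auxSchema) Var)}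
    (hX : Δ.IsStar X) {q : ℕ × ℕ} {f f' : Fact (fullSchema In Out Δ.auxSchema) Var}
    (hf : f ∈ X) (hf' : f' ∈ X) (hq : Sum.inr q ∈ Set.range f.args)
    (hq' : Sum.inr q ∈ Set.range f'.args) : f = f' := by
  rcases hX.cases f hf with ⟨E, rfl⟩ | ⟨R, s, j, rfl⟩
  · obtain ⟨m, hm⟩ := Δ.inl_of_mem_range_inAtom hq
    cases hm
  rcases hX.cases f' hf' with ⟨E, rfl⟩ | ⟨R', s', j', rfl⟩
  · obtain ⟨m, hm⟩ := Δ.inl_of_mem_range_inAtom hq'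
    cases hm
  obtain h | ⟨i, hi⟩ := Δ.mem_range_stateAtom hq
  · cases h
  obtain h | ⟨i', hi'⟩ := Δ.mem_range_stateAtom hq'
  · cases h
  cases hi
  cases hi'
  exact hX.state _ _ _ _ _ hf hf'

-- Rank input atoms 0, root variables 1, state atoms 2 and payload variables 3; every node then has
-- at most one neighbour of smaller rank. Nullary input atoms are isolated, so any number of them is
-- harmless.
variable {Δ} in
theorem IsStar.isAcyclic {X : Set (Fact (fullSchema In Out Δ.auxSchema) Var)}
    (hX : Δ.IsStar X) : IsAcyclic X := by
  have hinj : ∀ f ∈ X, Function.Injective f.args := by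
    intro f hf
    rcases hX.cases f hf with ⟨E, rfl⟩ | ⟨R, s, j, rfl⟩
    · exact Δ.injective_args_inAtom E
    · exact Δ.injective_args_stateAtom R s j
  refine ⟨hinj, ?_⟩
  let r : Var ⊕ Fact (fullSchema In Out Δ.auxSchema) Var → ℕ := fun w =>
    match w with
    | Sum.inl (Sum.inl _) => 1
    | Sum.inl (Sum.inr _) => 3
    | Sum.inr ⟨Sym.inp _, _⟩ => 0
    | Sum.inr ⟨_, _⟩ => 2
  have hrv : ∀ x : Var, r (Sum.inl x) = 1 ∨ r (Sum.inl x) = 3 := by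
    rintro (_ | _)
    exacts [Or.inl rfl, Or.inr rfl]
  have hrf : ∀ f, r (Sum.inr f) = 0 ∨ r (Sum.inr f) = 2 := by
    rintro ⟨_ | _ | _, _⟩
    exacts [Or.inl rfl, Or.inr rfl, Or.inr rfl]
  refine isAcyclic_of_rank r ?_ ?_
  · rintro (x | f) (y | f') hadj
    · exact absurd hadj not_incidenceGraph_adj_inl_inl
    · have := hrv x
      have := hrf f'
      omega
    · have := hrv y
      have := hrf f
      omega
    · exact absurd hadj not_incidenceGraph_adj_inr_inr
  · rintro (x | f) (y | g) (z | g') h₁ h₂ hr₁ hr₂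
    any_goals exact absurd h₁ not_incidenceGraph_adj_inl_inl
    any_goals exact absurd h₂ not_incidenceGraph_adj_inl_inl
    any_goals exact absurd h₁ not_incidenceGraph_adj_inr_inr
    any_goals exact absurd h₂ not_incidenceGraph_adj_inr_inr
    · rw [incidenceGraph_adj_inl_inr] at h₁ h₂
      congr 1
      rcases x with m | q
      · rcases hX.cases g h₁.1 with ⟨E, rfl⟩ | ⟨R, s, j, rfl⟩
        swap
        · exact absurd hr₁ (by simp [r, stateAtom, stateFact])
        rcases hX.cases g' h₂.1 with ⟨E', rfl⟩ | ⟨R, s, j, rfl⟩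
        swap
        · exact absurd hr₂ (by simp [r, stateAtom, stateFact])
        obtain ⟨hE, i, -⟩ := h₁
        obtain ⟨hE', i', -⟩ := h₂
        rw [hX.input E E' hE hE' (Nat.lt_of_le_of_lt (Nat.zero_le _) i.isLt)
          (Nat.lt_of_le_of_lt (Nat.zero_le _) i'.isLt)]
      · exact hX.eq_of_mem_range_inr h₁.1 h₂.1 h₁.2 h₂.2
    · rw [incidenceGraph_adj_inr_inl] at h₁ h₂
      congr 1
      rcases hX.cases f h₁.1 with ⟨E, rfl⟩ | ⟨R, s, j, rfl⟩
      · exact absurd hr₁ (by simp [r, inAtom])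
      · have key : ∀ y : Var, y ∈ Set.range (Δ.stateAtom R s j).args →
            r (Sum.inl y) < r (Sum.inr (Δ.stateAtom R s j)) → y = Sum.inl j := by
          intro y hy hr
          rcases Δ.mem_range_stateAtom hy with rfl | ⟨i, rfl⟩
          · rfl
          · exact absurd hr (by simp [r, stateAtom, stateFact])
        rw [key y h₁.2 hr₁, key z h₂.2 hr₂]

variable {Δ} in
theorem IsStar.subsingleton_occurrences {X : Set (Fact (fullSchema In Out Δ.auxSchema) Var)}
    (hX : Δ.IsStar X) (q : ℕ × ℕ) : (occurrences X (Sum.inr q)).Subsingleton := by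
  rintro ⟨f, i⟩ ⟨hf, hi⟩ ⟨f', i'⟩ ⟨hf', hi'⟩
  obtain rfl := hX.eq_of_mem_range_inr hf hf' ⟨i, hi⟩ ⟨i', hi'⟩
  exact congrArg (Sigma.mk f) (hX.isAcyclic.1 f hf (hi.trans hi'.symm))

variable {Δ} in
theorem IsStar.inr_of_aux_mem {X : Set (Fact (fullSchema In Out Δ.auxSchema) Var)}
    (hX : Δ.IsStar X) {A : Δ.auxSchema.Rel} {t : Fin (Δ.auxSchema.arity A) → Var}
    (hA : (⟨Sym.aux A, t⟩ : Fact (fullSchema In Out Δ.auxSchema) Var) ∈ X)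
    {i : Fin (Δ.auxSchema.arity A)} (hi : i ≠ (0 : Fin (Out.arity A.1 + 1))) :
    ∃ q, t i = Sum.inr q := by
  rcases hX.cases _ hA with ⟨E, h⟩ | ⟨R, s, j, h⟩
  · cases h
  · obtain ⟨R', s'⟩ := A
    cases h
    rcases Δ.args_stateAtom_cases (s := s) (j := j) i with ⟨h, -⟩ | ⟨i', -, h⟩
    · exact absurd h hi
    · exact ⟨_, h⟩

open Classical in
/-- The state atoms of a family of states. -/
noncomputable def stateAtoms (R : Out.Rel) {n : ℕ} (St : Fin n → Δ.State R) :
    Finset (Fact (fullSchema In Out Δ.auxSchema) Var) :=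
  Finset.univ.image fun j => Δ.stateAtom R (St j) j

theorem mem_stateAtoms {R : Out.Rel} {n : ℕ} {St : Fin n → Δ.State R}
    {f : Fact (fullSchema In Out Δ.auxSchema) Var} :
    f ∈ Δ.stateAtoms R St ↔ ∃ j, Δ.stateAtom R (St j) j = f := by
  simp [stateAtoms]

theorem eq_of_stateAtom_mem {R : Out.Rel} {n : ℕ} {St : Fin n → Δ.State R}
    {R₁ : Out.Rel} {s₁ : Δ.State R₁} {j : ℕ} (h₁ : Δ.stateAtom R₁ s₁ j ∈ Δ.stateAtoms R St) :
    ∃ hj : j < n, Δ.stateAtom R₁ s₁ j = Δ.stateAtom R (St ⟨j, hj⟩) j := by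
  obtain ⟨m, hm⟩ := Δ.mem_stateAtoms.1 h₁
  have : (m : ℕ) = j := by
    have h0 : Sum.inl j ∈ Set.range (Δ.stateAtom R (St m) m).args := by
      rw [hm]
      exact ⟨(0 : Fin (Out.arity R₁ + 1)), rfl⟩
    rcases Δ.mem_range_stateAtom h0 with h | ⟨i, h⟩
    · exact (Sum.inl_injective h).symm
    · cases h
  subst this
  exact ⟨m.isLt, hm.symm⟩

/-- The rule initialising a state at an argument of an input fact, placing there the marks
in `σ`. -/
noncomputable def initRule (R : Out.Rel) (E : In.Rel) (p : Fin (In.arity E))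
    (σ : Set (Fin (Out.arity R))) : Rule In Out Δ.auxSchema Var where
  head := Δ.stateFact R (fun _ => {l | ∀ i ∈ σ, Δ.mark R i l}, σ) (Sum.inl p) fun _ => Sum.inl p
  body := {Δ.inAtom E}
  head_rel _ h := by cases h
  body_rel a ha R h := by
    rw [Finset.mem_singleton] at ha
    subst ha
    cases h
  safe x hx := by
    refine ⟨_, Finset.mem_singleton_self _, p, ?_⟩
    obtain ⟨i, rfl⟩ := hx
    exact Fin.cases (motive := fun i : Fin (Out.arity R + 1) => Sum.inl (p : ℕ) =
      (Fin.cons (Sum.inl (p : ℕ)) (fun _ => Sum.inl (p : ℕ)) : Fin (Out.arity R + 1) → Var) i)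
      rfl (fun _ => rfl) i

/-- The state obtained at the `p`-th argument of a fact of `E` from states at its arguments. -/
def propState {R : Out.Rel} {E : In.Rel} (p : Fin (In.arity E))
    (St : Fin (In.arity E) → Δ.State R) : Δ.State R :=
  (fun B => {l | ∃ t : Fin (In.arity E) → Δ.Label, (⟨E, t⟩ : Fact In Δ.Label) ∈ B ∧ t p = l ∧
    ∀ j, t j ∈ (St j).1 B}, {i | ∃ j, i ∈ (St j).2})

theorem inr_mem_range_stateAtom {R : Out.Rel} (s : Δ.State R) (j : ℕ) (i : Fin (Out.arity R)) :
    (Sum.inr (j, (i : ℕ)) : Var) ∈ Set.range (Δ.stateAtom R s j).args :=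
  ⟨i.succ, rfl⟩

open Classical in
/-- The rule propagating states along an input fact. -/
noncomputable def propRule (R : Out.Rel) (E : In.Rel) (p : Fin (In.arity E))
    (St : Fin (In.arity E) → Δ.State R) (κ : Fin (Out.arity R) → Fin (In.arity E)) :
    Rule In Out Δ.auxSchema Var where
  head := Δ.stateFact R (Δ.propState p St) (Sum.inl p) fun i => Sum.inr (κ i, i)
  body := insert (Δ.inAtom E) (Δ.stateAtoms R St)
  head_rel _ h := by cases h
  body_rel a ha R h := by
    rcases Finset.mem_insert.1 ha with rfl | ha
    · cases h
    · obtain ⟨j, rfl⟩ := Δ.mem_stateAtoms.1 ha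
      cases h
  safe x hx := by
    obtain ⟨i, rfl⟩ := hx
    refine Fin.cases (motive := fun i : Fin (Out.arity R + 1) =>
      ∃ a ∈ insert (Δ.inAtom E) (Δ.stateAtoms R St), (Fin.cons (Sum.inl (p : ℕ))
        (fun i => Sum.inr ((κ i : ℕ), (i : ℕ))) : Fin (Out.arity R + 1) → Var) i ∈
          Set.range a.args) ?_ (fun i => ?_) i
    · exact ⟨_, Finset.mem_insert_self _ _, p, rfl⟩
    · exact ⟨_, Finset.mem_insert_of_mem (Δ.mem_stateAtoms.2 ⟨κ i, rfl⟩),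
        Δ.inr_mem_range_stateAtom (St (κ i)) (κ i) i⟩

open Classical in
/-- The rule deriving an output fact from states at several values and nullary input facts. -/
noncomputable def outRule (R : Out.Rel) (n : ℕ) (St : Fin n → Δ.State R)
    (κ : Fin (Out.arity R) → Fin n) (Z : Set In.Rel) : Rule In Out Δ.auxSchema Var where
  head := ⟨Sym.out R, fun i : Fin (Out.arity R) => Sum.inr ((κ i : ℕ), (i : ℕ))⟩
  body := Z.toFinite.toFinset.image Δ.inAtom ∪ Δ.stateAtoms R St
  head_rel _ h := by cases h
  body_rel a ha R h := by
    rcases Finset.mem_union.1 ha with ha | ha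
    · obtain ⟨E, -, rfl⟩ := Finset.mem_image.1 ha
      cases h
    · obtain ⟨j, rfl⟩ := Δ.mem_stateAtoms.1 ha
      cases h
  safe x hx := by
    obtain ⟨i, rfl⟩ := hx
    exact ⟨_, Finset.mem_union_right _ (Δ.mem_stateAtoms.2 ⟨κ i, rfl⟩),
      Δ.inr_mem_range_stateAtom (St (κ i)) (κ i) i⟩

theorem isStar_initRule (R : Out.Rel) (E : In.Rel) (p : Fin (In.arity E))
    (σ : Set (Fin (Out.arity R))) :
    Δ.IsStar ((Δ.initRule R E p σ).body : Set (Fact (fullSchema In Out Δ.auxSchema) Var)) := by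
  simp only [initRule, Finset.coe_singleton]
  refine ⟨fun f hf => Or.inl ⟨E, hf⟩, fun E₁ E₂ h₁ h₂ _ _ => ?_, fun R s R' s' j h _ => ?_⟩
  · exact Sym.inp.inj (congrArg Fact.rel (h₁.trans h₂.symm))
  · cases congrArg Fact.rel h

theorem isStar_propRule (R : Out.Rel) (E : In.Rel) (p : Fin (In.arity E))
    (St : Fin (In.arity E) → Δ.State R) (κ : Fin (Out.arity R) → Fin (In.arity E)) :
    Δ.IsStar ((Δ.propRule R E p St κ).body :
      Set (Fact (fullSchema In Out Δ.auxSchema) Var)) := by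
  classical
  have hin : ∀ E', Δ.inAtom E' ∈ (Δ.propRule R E p St κ).body → E' = E := by
    intro E' h
    rcases Finset.mem_insert.1 h with h | h
    · exact Sym.inp.inj (congrArg Fact.rel h)
    · obtain ⟨j, hj⟩ := Δ.mem_stateAtoms.1 h
      cases congrArg Fact.rel hj
  have hst : ∀ R' s j, Δ.stateAtom R' s j ∈ (Δ.propRule R E p St κ).body →
      Δ.stateAtom R' s j ∈ Δ.stateAtoms R St := by
    intro R' s j h
    rcases Finset.mem_insert.1 h with h | h
    · cases congrArg Fact.rel h
    · exact h
  refine ⟨fun f hf => ?_, fun E₁ E₂ h₁ h₂ _ _ => (hin _ h₁).trans (hin _ h₂).symm,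
    fun R₁ s₁ R₂ s₂ j h₁ h₂ => ?_⟩
  · rcases Finset.mem_insert.1 hf with h | h
    · exact Or.inl ⟨E, h⟩
    · obtain ⟨j, rfl⟩ := Δ.mem_stateAtoms.1 h
      exact Or.inr ⟨_, _, _, rfl⟩
  · obtain ⟨_, e₁⟩ := Δ.eq_of_stateAtom_mem (hst _ _ _ h₁)
    obtain ⟨_, e₂⟩ := Δ.eq_of_stateAtom_mem (hst _ _ _ h₂)
    exact e₁.trans e₂.symm

theorem isStar_outRule (R : Out.Rel) (n : ℕ) (St : Fin n → Δ.State R)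
    (κ : Fin (Out.arity R) → Fin n) (Z : Set In.Rel) (hZ : ∀ E ∈ Z, In.arity E = 0) :
    Δ.IsStar ((Δ.outRule R n St κ Z).body : Set (Fact (fullSchema In Out Δ.auxSchema) Var)) := by
  classical
  have hin : ∀ E', Δ.inAtom E' ∈ (Δ.outRule R n St κ Z).body → In.arity E' = 0 := by
    intro E' h
    rcases Finset.mem_union.1 h with h | h
    · obtain ⟨E, hE, h⟩ := Finset.mem_image.1 h
      obtain rfl := Sym.inp.inj (congrArg Fact.rel h)
      exact hZ E (by simpa using hE)
    · obtain ⟨j, hj⟩ := Δ.mem_stateAtoms.1 h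
      cases congrArg Fact.rel hj
  have hst : ∀ R' s j, Δ.stateAtom R' s j ∈ (Δ.outRule R n St κ Z).body →
      Δ.stateAtom R' s j ∈ Δ.stateAtoms R St := by
    intro R' s j h
    rcases Finset.mem_union.1 h with h | h
    · obtain ⟨E, -, h⟩ := Finset.mem_image.1 h
      cases congrArg Fact.rel h
    · exact h
  refine ⟨fun f hf => ?_, fun E₁ E₂ h₁ _ h _ => absurd (hin _ h₁) h.ne',
    fun R₁ s₁ R₂ s₂ j h₁ h₂ => ?_⟩
  · rcases Finset.mem_union.1 hf with h | h
    · obtain ⟨E, -, rfl⟩ := Finset.mem_image.1 h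
      exact Or.inl ⟨E, rfl⟩
    · obtain ⟨j, rfl⟩ := Δ.mem_stateAtoms.1 h
      exact Or.inr ⟨_, _, _, rfl⟩
  · obtain ⟨_, e₁⟩ := Δ.eq_of_stateAtom_mem (hst _ _ _ h₁)
    obtain ⟨_, e₂⟩ := Δ.eq_of_stateAtom_mem (hst _ _ _ h₂)
    exact e₁.trans e₂.symm

/-- The rules of the dual program. -/
inductive IsRule : Rule In Out Δ.auxSchema Var → Prop
  | start (R E p σ) : IsRule (Δ.initRule R E p σ)
  -- `κ i` is the argument whose payload supplies the `i`-th value. The condition `hκ` forces it to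
  -- be the argument where mark `i` was used, so no mark is used at two arguments.
  | prop (R E p St κ) (hκ : ∀ j, ∀ i ∈ (St j).2, κ i = j) : IsRule (Δ.propRule R E p St κ)
  -- One state per dual suffices, so bounding `n` keeps the rules finite in number. Nullary facts
  -- enter here because they are invisible to unravellings.
  | out (R n St κ Z) (hn : n ≤ Nat.card (Δ.duals R)) (hZ : ∀ E ∈ Z, In.arity E = 0)
      (hκ : ∀ j, ∀ i ∈ (St j).2, κ i = j)
      (href : ∀ B ∈ Δ.duals R, (∃ j, (St j).1 B = ∅) ∨
        ∃ E ∈ Z, ∀ t : Fin (In.arity E) → Δ.Label, (⟨E, t⟩ : Fact In Δ.Label) ∉ B) :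
      IsRule (Δ.outRule R n St κ Z)

theorem finite_isRule : {ρ | Δ.IsRule ρ}.Finite := by
  let X₁ := Σ R : Out.Rel, Σ E : In.Rel, Fin (In.arity E) × Set (Fin (Out.arity R))
  let X₂ := Σ R : Out.Rel, Σ E : In.Rel, Fin (In.arity E) × (Fin (In.arity E) → Δ.State R) ×
    (Fin (Out.arity R) → Fin (In.arity E))
  let X₃ := Σ R : Out.Rel, Σ n : Fin (Nat.card (Δ.duals R) + 1), (Fin n → Δ.State R) ×
    (Fin (Out.arity R) → Fin n) × Set In.Rel
  have h₁ := Set.finite_range fun x : X₁ => Δ.initRule x.1 x.2.1 x.2.2.1 x.2.2.2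
  have h₂ := Set.finite_range fun x : X₂ => Δ.propRule x.1 x.2.1 x.2.2.1 x.2.2.2.1 x.2.2.2.2
  have h₃ := Set.finite_range fun x : X₃ => Δ.outRule x.1 x.2.1 x.2.2.1 x.2.2.2.1 x.2.2.2.2
  refine ((h₁.union h₂).union h₃).subset ?_
  rintro _ (⟨R, E, p, σ⟩ | ⟨R, E, p, St, κ, -⟩ | ⟨R, n, St, κ, Z, hn, -, -, -⟩)
  · exact Or.inl (Or.inl ⟨⟨R, E, p, σ⟩, rfl⟩)
  · exact Or.inl (Or.inr ⟨⟨R, E, p, St, κ⟩, rfl⟩)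
  · exact Or.inr ⟨⟨R, ⟨n, by omega⟩, St, κ, Z⟩, rfl⟩

/-- The dual program: it derives an output fact when no dual structure admits a
homomorphism respecting the marks. -/
abbrev program : Program In Out where
  Aux := Δ.auxSchema
  Var := Var
  rules := {ρ | Δ.IsRule ρ}
  finite_rules := Δ.finite_isRule

/-- The articulation position is 0. It holds a root variable in every auxiliary head, while the
other positions of auxiliary body atoms hold payload variables, which occur once in a star. -/
theorem isTAM_program : Δ.program.IsTAM := by
  have hstar : ∀ ρ, Δ.IsRule ρ →
      Δ.IsStar (ρ.body : Set (Fact (fullSchema In Out Δ.auxSchema) Var)) := by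
    rintro _ (⟨R, E, p, σ⟩ | ⟨R, E, p, St, κ, -⟩ | ⟨R, n, St, κ, Z, -, hZ, -, -⟩)
    · exact Δ.isStar_initRule R E p σ
    · exact Δ.isStar_propRule R E p St κ
    · exact Δ.isStar_outRule R n St κ Z hZ
  have hhead : ∀ ρ, Δ.IsRule ρ → ∀ A (t : Fin (Δ.auxSchema.arity A) → Var),
      ρ.head = ⟨Sym.aux A, t⟩ → ∃ m, t (0 : Fin (Out.arity A.1 + 1)) = Sum.inl m := by
    rintro _ (⟨R, E, p, σ⟩ | ⟨R, E, p, St, κ, -⟩ | ⟨R, n, St, κ, Z, -, hZ, -, -⟩) A t h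
    · cases h
      exact ⟨p, rfl⟩
    · cases h
      exact ⟨p, rfl⟩
    · cases h
  refine ⟨fun ρ hρ => (hstar ρ hρ).isAcyclic,
    fun A => some (0 : Fin (Out.arity A.1 + 1)), fun ρ hρ x hx => ?_⟩
  obtain ⟨A, t, i, hA, hi, rfl⟩ := hx
  obtain ⟨q, hq⟩ := (hstar ρ hρ).inr_of_aux_mem hA fun h => hi (congrArg some h.symm)
  rw [hq]
  refine ⟨(hstar ρ hρ).subsingleton_occurrences q, ?_⟩
  rintro ⟨A', t', i', hA', hi', h⟩
  obtain ⟨m, hm⟩ := hhead ρ hρ A' t' hA'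
  have := Option.some.inj hi'
  subst this
  cases hm.symm.trans h

end DualFamily

end DualProgram

end Datalog

namespace Datalog

/-! ### Tree unravellings and arc consistency -/

section Unravelling

universe u

variable {In : Schema} {D : Type u}

/-- Finite trees unravelling the instance `I` from a value. -/
inductive Unravelling (I : Set (Fact In D)) : D → Type u
  | leaf (x : D) : Unravelling I x
  -- The argument `p` carries a subtree too, so several facts can be attached at the root.
  | node (f : Fact In D) (hf : f ∈ I) (p : Fin (In.arity f.rel))
      (sub : ∀ j, Unravelling I (f.args j)) : Unravelling I (f.args p)

namespace Unravelling

variable {I : Set (Fact In D)}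

/-- The values of the tree-shaped instance given by an unravelling. -/
def Elem : {x : D} → Unravelling I x → Type u
  | _, leaf _ => PUnit
  | _, node _ _ _ sub => Σ j, (sub j).Elem

/-- The root of an unravelling. -/
def root : {x : D} → (T : Unravelling I x) → T.Elem
  | _, leaf _ => PUnit.unit
  | _, node _ _ p sub => ⟨p, (sub p).root⟩

/-- The projection of an unravelling to the instance. -/
def proj : {x : D} → (T : Unravelling I x) → T.Elem → D
  | x, leaf _ => fun _ => x
  | _, node _ _ _ sub => fun e => (sub e.1).proj e.2

/-- The facts of the tree-shaped instance given by an unravelling. -/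
def facts : {x : D} → (T : Unravelling I x) → Set (Fact In T.Elem)
  | _, leaf _ => ∅
  | _, node f _ _ sub => {F | F = ⟨f.rel, fun j => ⟨j, (sub j).root⟩⟩ ∨
      ∃ j, ∃ F' ∈ (sub j).facts, F = F'.map (Sigma.mk j)}

@[simp]
theorem proj_root {x : D} (T : Unravelling I x) : T.proj T.root = x := by
  induction T with
  | leaf x => rfl
  | node f hf p sub ih => exact ih p

variable {Λ : Type}

/-- The labels of the root under homomorphisms to `B` admitted by `μ`. -/
def rootLabels {x : D} (T : Unravelling I x) (B : Set (Fact In Λ)) (μ : T.Elem → Λ → Prop) :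
    Set Λ :=
  {l | ∃ g : T.Elem → Λ, (∀ F ∈ T.facts, F.map g ∈ B) ∧ (∀ e, μ e (g e)) ∧ g T.root = l}

/-- The subtrees are disjoint and joined only by the fact on their roots, so their homomorphisms can
be chosen independently. -/
theorem mem_rootLabels_node {f : Fact In D} {hf : f ∈ I} {p : Fin (In.arity f.rel)}
    {sub : ∀ j, Unravelling I (f.args j)} {B : Set (Fact In Λ)}
    {μ : (node f hf p sub).Elem → Λ → Prop} {l : Λ} :
    l ∈ (node f hf p sub).rootLabels B μ ↔
      ∃ t : Fin (In.arity f.rel) → Λ, (⟨f.rel, t⟩ : Fact In Λ) ∈ B ∧ t p = l ∧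
        ∀ j, t j ∈ (sub j).rootLabels B fun e => μ ⟨j, e⟩ := by
  constructor
  · rintro ⟨g, hg, hμ, rfl⟩
    refine ⟨fun j => g ⟨j, (sub j).root⟩, hg _ (Or.inl rfl), rfl, fun j => ?_⟩
    exact ⟨fun e => g ⟨j, e⟩, fun F hF => hg _ (Or.inr ⟨j, F, hF, rfl⟩), fun e => hμ ⟨j, e⟩, rfl⟩
  · rintro ⟨t, ht, rfl, hsub⟩
    choose g hg hμ hroot using hsub
    refine ⟨fun e => g e.1 e.2, ?_, fun e => hμ e.1 e.2, hroot p⟩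
    rintro _ (rfl | ⟨j, F, hF, rfl⟩)
    · have : (fun j => g j (sub j).root) = t := funext hroot
      rw [← this] at ht
      exact ht
    · exact hg j F hF

theorem rootLabels_subset_of_root {x : D} (T : Unravelling I x) (B : Set (Fact In Λ))
    (adm : D → Λ → Prop) : T.rootLabels B (fun e => adm (T.proj e)) ⊆ {l | adm x l} := by
  rintro _ ⟨g, -, hμ, rfl⟩
  have : adm (T.proj T.root) (g T.root) := hμ T.root
  rwa [proj_root] at this

/-- Descending in `T` always to the subtree at `p` stays over `x` and ends at a leaf; `T'` is
grafted there. -/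
theorem exists_subset_inter {x : D} (T T' : Unravelling I x) (B : Set (Fact In Λ))
    (adm : D → Λ → Prop) : ∃ T'' : Unravelling I x,
      T''.rootLabels B (fun e => adm (T''.proj e)) ⊆ T.rootLabels B (fun e => adm (T.proj e)) ∧
      T''.rootLabels B (fun e => adm (T''.proj e)) ⊆
        T'.rootLabels B (fun e => adm (T'.proj e)) := by
  classical
  induction T with
  | leaf x =>
    refine ⟨T', fun l hl => ?_, subset_rfl⟩
    exact ⟨fun _ => l, fun F hF => absurd hF (Set.notMem_empty _),
      fun _ => T'.rootLabels_subset_of_root B adm hl, rfl⟩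
  | node f hf p sub ih =>
    obtain ⟨T₀, h₁, h₂⟩ := ih p T'
    have hle : ∀ j, (Function.update sub p T₀ j).rootLabels B
        (fun e => adm ((Function.update sub p T₀ j).proj e)) ⊆
        (sub j).rootLabels B (fun e => adm ((sub j).proj e)) := by
      intro j
      by_cases hj : j = p
      · subst hj
        rwa [Function.update_self]
      · rw [Function.update_of_ne hj]
    refine ⟨node f hf p (Function.update sub p T₀), fun l hl => ?_, fun l hl => ?_⟩
    · obtain ⟨t, ht, htp, hsub⟩ := mem_rootLabels_node.1 hl
      exact mem_rootLabels_node.2 ⟨t, ht, htp, fun j => hle j (hsub j)⟩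
    · obtain ⟨t, -, rfl, hsub⟩ := mem_rootLabels_node.1 hl
      have := hsub p
      change t p ∈ (Function.update sub p T₀ p).rootLabels B
        (fun e => adm ((Function.update sub p T₀ p).proj e)) at this
      rw [Function.update_self] at this
      exact h₂ this

/-- By grafting, the label sets are directed downwards, so one of minimal cardinality is least. -/
theorem exists_least [Finite Λ] (x : D) (B : Set (Fact In Λ)) (adm : D → Λ → Prop) :
    ∃ T : Unravelling I x, ∀ T' : Unravelling I x,
      T.rootLabels B (fun e => adm (T.proj e)) ⊆ T'.rootLabels B (fun e => adm (T'.proj e)) := by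
  obtain ⟨_, ⟨T, rfl⟩, hT⟩ := wellFounded_lt.has_min
    (Set.range fun T : Unravelling I x => (T.rootLabels B fun e => adm (T.proj e)).ncard)
    ⟨_, leaf x, rfl⟩
  refine ⟨T, fun T' => ?_⟩
  obtain ⟨T'', h₁, h₂⟩ := exists_subset_inter T T' B adm
  have := Set.eq_of_subset_of_ncard_le h₁ (not_lt.1 (hT _ ⟨T'', rfl⟩)) (Set.toFinite _)
  rwa [← this]

/-- If no unravelling refutes `B`, then the labels surviving all unravellings are arc
consistent. -/
theorem exists_arcConsistent [Finite Λ] [Nonempty Λ] (B : Set (Fact In Λ)) (adm : D → Λ → Prop)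
    (hnull : ∀ f ∈ I, In.arity f.rel = 0 →
      ∃ t : Fin (In.arity f.rel) → Λ, (⟨f.rel, t⟩ : Fact In Λ) ∈ B)
    (hne : ∀ x ∈ activeDomain I, ∀ T : Unravelling I x,
      (T.rootLabels B fun e => adm (T.proj e)).Nonempty) :
    ∃ g : D → Set Λ, (∀ x, (g x).Nonempty) ∧ (∀ f ∈ I, ArcConsistent B g f) ∧
      ∀ x ∈ activeDomain I, ∀ l ∈ g x, adm x l := by
  classical
  choose T hT using fun x : D => exists_least (I := I) x B adm
  let g : D → Set Λ := fun x =>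
    if x ∈ activeDomain I then (T x).rootLabels B (fun e => adm ((T x).proj e)) else Set.univ
  have hg : ∀ x ∈ activeDomain I, g x = (T x).rootLabels B (fun e => adm ((T x).proj e)) :=
    fun x hx => if_pos hx
  have hgne : ∀ x, (g x).Nonempty := by
    intro x
    by_cases hx : x ∈ activeDomain I
    · rw [hg x hx]
      exact hne x hx _
    · simp only [g, if_neg hx]
      exact Set.univ_nonempty
  refine ⟨g, hgne, fun f hf => ?_, fun x hx l hl => ?_⟩
  · have hact : ∀ j, f.args j ∈ activeDomain I := fun j => ⟨f, hf, j, rfl⟩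
    have hext : ∀ i, ∀ l ∈ g (f.args i), ∃ t : Fin (In.arity f.rel) → Λ,
        (⟨f.rel, t⟩ : Fact In Λ) ∈ B ∧ t i = l ∧ ∀ j, t j ∈ g (f.args j) := by
      intro i l hl
      rw [hg _ (hact i)] at hl
      -- Joining the least unravellings of the arguments by `f` gives another unravelling of `f.args
      -- i`, whose label set contains the least one.
      obtain ⟨t, ht, hti, hsub⟩ := mem_rootLabels_node.1
        (hT _ (node f hf i fun j => T (f.args j)) hl)
      refine ⟨t, ht, hti, fun j => ?_⟩
      rw [hg _ (hact j)]
      exact hsub j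
    refine ⟨?_, hext⟩
    rcases Nat.eq_zero_or_pos (In.arity f.rel) with h0 | hpos
    · obtain ⟨t, ht⟩ := hnull f hf h0
      exact ⟨t, ht, fun j => absurd j.isLt (by omega)⟩
    · obtain ⟨l, hl⟩ := hgne (f.args ⟨0, hpos⟩)
      obtain ⟨t, ht, -, h⟩ := hext _ l hl
      exact ⟨t, ht, h⟩
  · rw [hg x hx] at hl
    exact (T x).rootLabels_subset_of_root B adm hl

end Unravelling

end Unravelling

/-! ### Soundness and completeness of the dual program -/

namespace DualFamily

universe u

variable {In Out : Schema} {Δ : DualFamily In Out}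

/-- The dual structures of `Δ` detect the query `Q`. -/
structure Detects (Δ : DualFamily In Out)
    (Q : ∀ {D : Type u}, Set (Fact In D) → Set (Fact Out D)) : Prop where
  exists_hom : ∀ (R : Out.Rel) (D : Type u) [Nonempty D] (I : Set (Fact In D))
    (m : Fin (Out.arity R) → D → Prop), (∀ t, ⟨R, t⟩ ∈ Q I → ∃ i, ¬ m i (t i)) →
      ∃ B ∈ Δ.duals R, ∃ g : D → Δ.Label, (∀ f ∈ I, f.map g ∈ B) ∧
        ∀ i x, Δ.mark R i (g x) ↔ m i x
  arcConsistent : ∀ (R : Out.Rel), ∀ B ∈ Δ.duals R, ∀ (D : Type u) (I : Set (Fact In D))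
    (g : D → Set Δ.Label), (∀ x, (g x).Nonempty) → (∀ f ∈ I, ArcConsistent B g f) →
      ∀ t, ⟨R, t⟩ ∈ Q I → ∃ l : Fin (Out.arity R) → Δ.Label,
        (∀ j, l j ∈ g (t j)) ∧ ∃ i, ¬ Δ.mark R i (l i)

variable {Q : ∀ {D : Type u}, Set (Fact In D) → Set (Fact Out D)} {D : Type u}

/-- A homomorphism is a singleton-valued arc consistent labelling, so the second clause of `Detects`
also yields the converse of the first. -/
theorem Detects.exists_not_mark (hΔ : Δ.Detects Q) {R : Out.Rel} {B : Set (Fact In Δ.Label)}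
    (hB : B ∈ Δ.duals R) {I : Set (Fact In D)} {g : D → Δ.Label} (hg : ∀ f ∈ I, f.map g ∈ B)
    {t : Fin (Out.arity R) → D} (ht : ⟨R, t⟩ ∈ Q I) : ∃ i, ¬ Δ.mark R i (g (t i)) := by
  obtain ⟨l, hl, i, hi⟩ := hΔ.arcConsistent R B hB D I (fun x => {g x})
    (fun x => Set.singleton_nonempty _) (fun f hf => arcConsistent_singleton (hg f hf)) t ht
  refine ⟨i, ?_⟩
  rwa [← show l i = g (t i) from hl i]

/-- The intended meaning of the facts derived by the dual program. -/
def meaning (Δ : DualFamily In Out) (I : Set (Fact In D)) (QI : Set (Fact Out D)) :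
    Set (Fact (fullSchema In Out Δ.auxSchema) D) :=
  {F | match F with
    | ⟨.inp R, t⟩ => (⟨R, t⟩ : Fact In D) ∈ I
    | ⟨.out R, t⟩ => (⟨R, t⟩ : Fact Out D) ∈ QI
    | ⟨.aux ⟨R, s⟩, t⟩ => ∀ B ∈ Δ.duals R, ∀ g : D → Δ.Label, (∀ f ∈ I, f.map g ∈ B) →
        (∀ i ∈ s.2, Δ.mark R i (g (t (Fin.succ i)))) → g (t (0 : Fin (Out.arity R + 1))) ∈ s.1 B}

theorem stateFact_mem_meaning {I : Set (Fact In D)} {QI : Set (Fact Out D)} {R : Out.Rel}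
    {s : Δ.State R} {x : D} {y : Fin (Out.arity R) → D} :
    Δ.stateFact R s x y ∈ Δ.meaning I QI ↔
      ∀ B ∈ Δ.duals R, ∀ g : D → Δ.Label, (∀ f ∈ I, f.map g ∈ B) →
        (∀ i ∈ s.2, Δ.mark R i (g (y i))) → g x ∈ s.1 B :=
  Iff.rfl

/-- Soundness: a state bounds the labels of its value under all homomorphisms respecting the used
marks. If an output rule derived a non-answer, marking exactly its values would give a homomorphism
to some dual, which the rule has refuted. -/
theorem Detects.isModel_meaning [Nonempty D] (hΔ : Δ.Detects Q) (I : Set (Fact In D)) :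
    Δ.program.IsModel (Δ.meaning I (Q I)) := by
  classical
  rintro _ (⟨R, E, p, σ⟩ | ⟨R, E, p, St, κ, hκ⟩ | ⟨R, n, St, κ, Z, -, hZ, hκ, href⟩) ν hbody
  · change (Δ.stateFact R _ _ _).map ν ∈ _
    rw [map_stateFact, stateFact_mem_meaning]
    exact fun B _ g _ hm i hi => hm i hi
  · change (Δ.stateFact R _ _ _).map ν ∈ _
    rw [map_stateFact, stateFact_mem_meaning]
    intro B hB g hg hm
    have hE : (⟨E, fun j => ν (Sum.inl j)⟩ : Fact In D) ∈ I :=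
      hbody _ (Finset.mem_insert_self _ _)
    refine ⟨fun j => g (ν (Sum.inl j)), hg _ hE, rfl, fun j => ?_⟩
    have hj := hbody _ (Finset.mem_insert_of_mem (Δ.mem_stateAtoms.2 ⟨j, rfl⟩))
    change (Δ.stateFact R _ _ _).map ν ∈ _ at hj
    rw [map_stateFact, stateFact_mem_meaning] at hj
    refine hj B hB g hg fun i hi => ?_
    have := hm i ⟨j, hi⟩
    rwa [hκ j i hi] at this
  · change (⟨R, fun i => ν (Sum.inr (κ i, i))⟩ : Fact Out D) ∈ Q I
    by_contra hcon
    obtain ⟨B, hB, g, hg, hmark⟩ := hΔ.exists_hom R D I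
      (fun i x => x = ν (Sum.inr (κ i, i))) (fun t ht => by
        by_contra hall
        push Not at hall
        have := funext hall
        subst this
        exact hcon ht)
    rcases href B hB with ⟨j, hj⟩ | ⟨E, hE, hEB⟩
    · have hjb := hbody _ (Finset.mem_union_right _ (Δ.mem_stateAtoms.2 ⟨j, rfl⟩))
      change (Δ.stateFact R _ _ _).map ν ∈ _ at hjb
      rw [map_stateFact, stateFact_mem_meaning] at hjb
      have := hjb B hB g hg fun i hi => (hmark i _).2 (by rw [hκ j i hi])
      rw [hj] at this
      exact this
    · have hEI : (⟨E, fun j => ν (Sum.inl j)⟩ : Fact In D) ∈ I :=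
        hbody _ (Finset.mem_union_left _ (Finset.mem_image_of_mem _ (by simpa using hE)))
      exact hEB _ (hg _ hEI)

theorem Detects.eval_subset [Nonempty D] (hΔ : Δ.Detects Q) (I : Set (Fact In D)) :
    Δ.program.eval I ⊆ Q I := by
  intro f hf
  have hI : Δ.program.embedInput I ⊆ Δ.meaning I (Q I) := by
    rintro _ ⟨f, hf, rfl⟩
    exact hf
  exact (hΔ.isModel_meaning I).chase_subset hI hf

/-- The component of `b` in the `j`-th summand, with a default value. -/
noncomputable def component {ι : Type*} {X : ι → Type*} (b : Σ j, X j) (j : ι) (d : X j) : X j :=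
  open Classical in if h : b.1 = j then h ▸ b.2 else d

theorem component_self {ι : Type*} {X : ι → Type*} (b : Σ j, X j) (d : X b.1) :
    component b b.1 d = b.2 := by
  simp [component]

/-- A valuation of the variables of the dual program. -/
noncomputable def valuation {n k : ℕ} [Nonempty D] (x : Fin n → D) (y : Fin n → Fin k → D) :
    Var → D
  | Sum.inl j => if h : j < n then x ⟨j, h⟩ else Classical.arbitrary D
  | Sum.inr (j, i) => if h : j < n ∧ i < k then y ⟨j, h.1⟩ ⟨i, h.2⟩ else Classical.arbitrary D

@[simp]
theorem valuation_inl {n k : ℕ} [Nonempty D] (x : Fin n → D) (y : Fin n → Fin k → D)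
    (j : Fin n) : valuation x y (Sum.inl j) = x j := by
  simp [valuation]

@[simp]
theorem valuation_inr {n k : ℕ} [Nonempty D] (x : Fin n → D) (y : Fin n → Fin k → D)
    (j : Fin n) (i : Fin k) : valuation x y (Sum.inr (j, i)) = y j i := by
  simp [valuation]

theorem stateFact_mem_chase_of_prop [Nonempty D] {I : Set (Fact In D)} {R : Out.Rel}
    {f : Fact In D} (hf : f ∈ I) (p : Fin (In.arity f.rel))
    (St : Fin (In.arity f.rel) → Δ.State R) (κ : Fin (Out.arity R) → Fin (In.arity f.rel))
    (hκ : ∀ j, ∀ i ∈ (St j).2, κ i = j) (y : Fin (In.arity f.rel) → Fin (Out.arity R) → D)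
    (hSt : ∀ j, Δ.stateFact R (St j) (f.args j) (y j) ∈ Δ.program.chase I) :
    Δ.stateFact R (Δ.propState p St) (f.args p) (fun i => y (κ i) i) ∈ Δ.program.chase I := by
  classical
  have := Δ.program.isModel_chase I (Δ.propRule R f.rel p St κ) (IsRule.prop R f.rel p St κ hκ)
    (valuation f.args y) (fun a ha => by
      rcases Finset.mem_insert.1 ha with rfl | ha
      · have : (Δ.inAtom f.rel).map (valuation f.args y) =
            ⟨Sym.inp f.rel, f.args⟩ :=
          congrArg (fun t => (⟨Sym.inp f.rel, t⟩ : Fact (fullSchema In Out Δ.auxSchema) D))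
            (funext fun j : Fin (In.arity f.rel) => valuation_inl f.args y j)
        change (Δ.inAtom f.rel).map (valuation f.args y) ∈ _
        rw [this]
        exact Program.inp_mem_chase hf
      · obtain ⟨j, rfl⟩ := Δ.mem_stateAtoms.1 ha
        change (Δ.stateFact R _ _ _).map (valuation f.args y) ∈ _
        rw [map_stateFact]
        simpa using hSt j)
  change (Δ.stateFact R _ _ _).map (valuation f.args y) ∈ _ at this
  rw [map_stateFact] at this
  simpa using this

theorem stateFact_mem_chase_of_init [Nonempty D] {I : Set (Fact In D)} (R : Out.Rel)
    {x : D} (hx : x ∈ activeDomain I) (σ : Set (Fin (Out.arity R))) :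
    Δ.stateFact R (fun _ => {l | ∀ i ∈ σ, Δ.mark R i l}, σ) x (fun _ => x) ∈
      Δ.program.chase I := by
  obtain ⟨f, hf, p, rfl⟩ := hx
  let y : Fin (In.arity f.rel) → Fin 0 → D := fun _ i => i.elim0
  have := Δ.program.isModel_chase I (Δ.initRule R f.rel p σ) (IsRule.start R f.rel p σ)
    (valuation f.args y) (fun a ha => by
      obtain rfl := Finset.mem_singleton.1 ha
      have : (Δ.inAtom f.rel).map (valuation f.args y) =
          ⟨Sym.inp f.rel, f.args⟩ :=
        congrArg (fun t => (⟨Sym.inp f.rel, t⟩ : Fact (fullSchema In Out Δ.auxSchema) D))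
          (funext fun j : Fin (In.arity f.rel) => valuation_inl f.args y j)
      change (Δ.inAtom f.rel).map (valuation f.args y) ∈ _
      rw [this]
      exact Program.inp_mem_chase hf)
  change (Δ.stateFact R _ _ _).map (valuation f.args y) ∈ _ at this
  rw [map_stateFact] at this
  simpa using this

/-- The dual program computes, along an unravelling, the labels of the root under homomorphisms
respecting the marks placed at `b`. -/
theorem exists_stateFact_mem_chase [Nonempty D] {I : Set (Fact In D)} (R : Out.Rel) {x : D}
    (T : Unravelling I x) (hx : x ∈ activeDomain I) (σ : Set (Fin (Out.arity R)))
    (b : Fin (Out.arity R) → T.Elem) :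
    ∃ s : Δ.State R, s.2 = σ ∧ Δ.stateFact R s x (fun i => T.proj (b i)) ∈ Δ.program.chase I ∧
      ∀ B, s.1 B ⊆ T.rootLabels B fun e l => ∀ i ∈ σ, b i = e → Δ.mark R i l := by
  induction T generalizing σ with
  | leaf x =>
    refine ⟨_, rfl, stateFact_mem_chase_of_init R hx σ, fun B l hl => ?_⟩
    exact ⟨fun _ => l, fun F hF => absurd hF (Set.notMem_empty _), fun _ i hi _ => hl i hi, rfl⟩
  | node f hf p sub ih =>
    choose St hσ hmem hlab using fun j => ih j ⟨f, hf, j, rfl⟩ {i ∈ σ | (b i).1 = j}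
      (fun i => component (b i) j (sub j).root)
    have hκ : ∀ j, ∀ i ∈ (St j).2, (b i).1 = j := by
      intro j i hi
      rw [hσ] at hi
      exact hi.2
    refine ⟨Δ.propState p St, ?_, ?_, fun B l hl => ?_⟩
    · ext i
      simp only [propState, hσ, Set.mem_ofPred_eq]
      exact ⟨fun ⟨_, h, _⟩ => h, fun h => ⟨_, h, rfl⟩⟩
    · have := stateFact_mem_chase_of_prop hf p St (fun i => (b i).1) hκ _ hmem
      have hb : (fun i => (sub (b i).1).proj (component (b i) (b i).1 (sub (b i).1).root)) =
          fun i => (Unravelling.node f hf p sub).proj (b i) :=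
        funext fun i => congrArg (sub (b i).1).proj (component_self (b i) _)
      rwa [hb] at this
    · obtain ⟨t, ht, htp, hts⟩ := hl
      refine Unravelling.mem_rootLabels_node.2 ⟨t, ht, htp, fun j => ?_⟩
      obtain ⟨g, hg, hm, hr⟩ := hlab j B (hts j)
      refine ⟨g, hg, fun e i hi hbe => hm e i ⟨hi, ?_⟩ ?_, hr⟩
      · rw [hbe]
      · rw [hbe]
        exact component_self (⟨j, e⟩ : Σ j, (sub j).Elem) _

theorem out_mem_eval [Nonempty D] {I : Set (Fact In D)} {R : Out.Rel} {n : ℕ}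
    (hn : n ≤ Nat.card (Δ.duals R)) (St : Fin n → Δ.State R) (κ : Fin (Out.arity R) → Fin n)
    (hκ : ∀ j, ∀ i ∈ (St j).2, κ i = j) (x : Fin n → D) (y : Fin n → Fin (Out.arity R) → D)
    (hSt : ∀ j, Δ.stateFact R (St j) (x j) (y j) ∈ Δ.program.chase I)
    (href : ∀ B ∈ Δ.duals R, (∃ j, (St j).1 B = ∅) ∨
      ∃ f ∈ I, In.arity f.rel = 0 ∧
        ∀ t : Fin (In.arity f.rel) → Δ.Label, (⟨f.rel, t⟩ : Fact In Δ.Label) ∉ B) :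
    (⟨R, fun i => y (κ i) i⟩ : Fact Out D) ∈ Δ.program.eval I := by
  classical
  have := Δ.program.isModel_chase I
    (Δ.outRule R n St κ {E | In.arity E = 0 ∧ ∃ f ∈ I, f.rel = E})
    (IsRule.out R n St κ _ hn (fun E hE => hE.1) hκ (fun B hB => (href B hB).imp id
      fun ⟨f, hf, h0, ht⟩ => ⟨f.rel, ⟨h0, f, hf, rfl⟩, ht⟩))
    (valuation x y) (fun a ha => by
      rcases Finset.mem_union.1 ha with ha | ha
      · obtain ⟨E, hE, rfl⟩ := Finset.mem_image.1 ha
        obtain ⟨h0, f, hf, rfl⟩ := (Set.Finite.mem_toFinset _).1 hE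
        have : (Δ.inAtom f.rel).map (valuation x y) = ⟨Sym.inp f.rel, f.args⟩ :=
          congrArg (fun t => (⟨Sym.inp f.rel, t⟩ : Fact (fullSchema In Out Δ.auxSchema) D))
            (funext fun j : Fin (In.arity f.rel) => absurd j.isLt (by omega))
        change (Δ.inAtom f.rel).map (valuation x y) ∈ _
        rw [this]
        exact Program.inp_mem_chase hf
      · obtain ⟨j, rfl⟩ := Δ.mem_stateAtoms.1 ha
        change (Δ.stateFact R _ _ _).map (valuation x y) ∈ _
        rw [map_stateFact]
        simpa using hSt j)
  have heq : (fun i => y (κ i) i) = fun i : Fin (Out.arity R) =>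
      valuation x y (Sum.inr ((κ i : ℕ), (i : ℕ))) := by
    funext i
    rw [valuation_inr]
  rw [heq]
  exact this

/-- Completeness: for an answer `R(a)`, every dual is refuted by a nullary fact or by an unravelling
in which all copies of `a i` must carry mark `i`. The disjoint union `K` of these trees, with the
nullary facts, has an answer lying over `a`, and the program can follow the trees with that answer
as payload. -/
theorem Detects.subset_eval [Nonempty D] [Nonempty Δ.Label] (hΔ : Δ.Detects Q)
    (I : Set (Fact In D)) (hact : activeDomain (Q I) ⊆ activeDomain I) :
    Q I ⊆ Δ.program.eval I := by
  classical
  rintro ⟨R, a⟩ ha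
  have hfin := finite_fact In Δ.Label
  let adm : D → Δ.Label → Prop := fun x l => ∀ i, x = a i → Δ.mark R i l
  let Null : Set (Fact In Δ.Label) → Prop := fun B => ∃ f ∈ I, In.arity f.rel = 0 ∧
    ∀ t : Fin (In.arity f.rel) → Δ.Label, (⟨f.rel, t⟩ : Fact In Δ.Label) ∉ B
  -- Otherwise the surviving labels are arc consistent and all those at `a i` carry mark `i`, which
  -- the second clause of `Detects` forbids.
  have hstep : ∀ B ∈ Δ.duals R, ¬ Null B → ∃ x ∈ activeDomain I, ∃ T : Unravelling I x,
      T.rootLabels B (fun e => adm (T.proj e)) = ∅ := by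
    intro B hB hnull
    by_contra hcon
    push Not at hcon
    simp only [Null] at hnull
    push Not at hnull
    obtain ⟨g, hgne, hgarc, hgadm⟩ := Unravelling.exists_arcConsistent B adm hnull hcon
    obtain ⟨l, hl, i, hi⟩ := hΔ.arcConsistent R B hB D I g hgne hgarc a ha
    exact hi (hgadm _ (hact ⟨_, ha, i, rfl⟩) _ (hl i) i rfl)
  let C := {B : Set (Fact In Δ.Label) // B ∈ Δ.duals R ∧ ¬ Null B}
  choose x hx T hT using fun c : C => hstep c.1 c.2.1 c.2.2
  -- The extra point makes the domain nonempty even if there are no trees.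
  let F := Option (Σ c : C, (T c).Elem)
  let inj : ∀ c : C, (T c).Elem → F := fun c e => some ⟨c, e⟩
  let K : Set (Fact In F) := {f | (∃ c, ∃ f' ∈ (T c).facts, f = f'.map (inj c)) ∨
    (In.arity f.rel = 0 ∧ ∃ f' ∈ I, f'.rel = f.rel)}
  -- Marking all copies of `a i` in `K` leaves no homomorphism to any dual, so some answer of `K`
  -- consists of such copies.
  obtain ⟨b, hb, hba⟩ : ∃ b : Fin (Out.arity R) → F, ⟨R, b⟩ ∈ Q K ∧
      ∀ i, ∃ c e, b i = inj c e ∧ (T c).proj e = a i := by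
    by_contra hcon
    push Not at hcon
    obtain ⟨B, hB, g, hg, hmark⟩ := hΔ.exists_hom R F K
      (fun i d => ∃ c e, d = inj c e ∧ (T c).proj e = a i) (fun t ht => by
        obtain ⟨i, hi⟩ := hcon t ht
        refine ⟨i, ?_⟩
        rintro ⟨c, e, h₁, h₂⟩
        exact hi c e h₁ h₂)
    by_cases hnull : Null B
    · obtain ⟨f, hf, h0, hfB⟩ := hnull
      exact hfB _ (hg ⟨f.rel, fun j => absurd j.isLt (by omega)⟩ (Or.inr ⟨h0, f, hf, rfl⟩))
    · let c : C := ⟨B, hB, hnull⟩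
      have : g (inj c (T c).root) ∈ (T c).rootLabels B (fun e => adm ((T c).proj e)) :=
        ⟨fun e => g (inj c e), fun f hf => hg _ (Or.inl ⟨c, f, hf, rfl⟩),
          fun e i hi => (hmark i _).2 ⟨c, e, rfl, hi⟩, rfl⟩
      rw [hT c] at this
      exact this
  choose κ e hbe hproj using hba
  choose St hσ hmem hlab using fun c : C => exists_stateFact_mem_chase (Δ := Δ) R (T c) (hx c)
    {i | κ i = c} (fun i => component (X := fun c => (T c).Elem) ⟨κ i, e i⟩ c (T c).root)
  -- Now only the single copy `b i` is marked. Every dual is still refuted: homomorphisms of the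
  -- trees would combine to one on `K` marking the whole answer `b`.
  have href : ∀ B ∈ Δ.duals R, (∃ c, (St c).1 B = ∅) ∨ Null B := by
    intro B hB
    by_contra hcon
    push Not at hcon
    obtain ⟨hne, hnull⟩ := hcon
    choose l hl using hne
    choose g hg hm _ using fun c => hlab c B (hl c)
    let G : F → Δ.Label := fun d => d.elim (Classical.arbitrary _) fun q => g q.1 q.2
    obtain ⟨i, hi⟩ := hΔ.exists_not_mark hB (I := K) (g := G) (t := b) (by
      rintro f (⟨c, f', hf', rfl⟩ | ⟨h0, f', hf', hrel⟩)
      · exact hg c f' hf'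
      · simp only [Null] at hnull
        push Not at hnull
        obtain ⟨R', t'⟩ := f
        obtain ⟨R'', t''⟩ := f'
        dsimp only at hrel h0
        subst hrel
        obtain ⟨t, ht⟩ := hnull _ hf' h0
        have : t = G ∘ t' := funext fun j => absurd j.isLt (by dsimp only; omega)
        rw [this] at ht
        exact ht) hb
    refine hi ?_
    rw [hbe i]
    exact hm (κ i) (e i) i rfl (component_self (⟨κ i, e i⟩ : Σ c, (T c).Elem) _)
  have hcard : Nat.card C ≤ Nat.card (Δ.duals R) :=
    Nat.card_le_card_of_injective (fun c : C => (⟨c.1, c.2.1⟩ : Δ.duals R))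
      fun _ _ h => Subtype.ext (Subtype.mk.inj h)
  let ε := Finite.equivFin C
  have hout := out_mem_eval (I := I) hcard (fun j => St (ε.symm j)) (fun i => ε (κ i))
    (fun j i hi => by
      rw [hσ] at hi
      rw [show κ i = ε.symm j from hi, Equiv.apply_symm_apply])
    (fun j => x (ε.symm j))
    (fun j i => (T (ε.symm j)).proj
      (component (X := fun c => (T c).Elem) ⟨κ i, e i⟩ (ε.symm j) (T (ε.symm j)).root))
    (fun j => hmem _)
    (fun B hB => (href B hB).imp (fun ⟨c, hc⟩ => ⟨ε c, by rwa [Equiv.symm_apply_apply]⟩) id)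
  have hpay : (fun i => (T (ε.symm (ε (κ i)))).proj
      (component (X := fun c => (T c).Elem) ⟨κ i, e i⟩ (ε.symm (ε (κ i))) (T (ε.symm (ε (κ i)))).root)) = a := by
    funext i
    rw [Equiv.symm_apply_apply, component_self (⟨κ i, e i⟩ : Σ c, (T c).Elem)]
    exact hproj i
  rw [hpay] at hout
  exact hout

end DualFamily

-- From finite duals to a program, and the composition theorem

universe u

/-- A query with finite duals that introduces no new values is computed by a tree-shaped almost
monadic program. -/
theorem HasFiniteDuals.exists_isTAM {In Out : Schema}
    {Q : ∀ {D : Type u}, Set (Fact In D) → Set (Fact Out D)} (hQ : HasFiniteDuals Q)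
    (hact : ∀ {D : Type u} (I : Set (Fact In D)), activeDomain (Q I) ⊆ activeDomain I) :
    ∃ P : Program In Out, P.IsTAM ∧
      ∀ (D : Type u) [Nonempty D] (I : Set (Fact In D)), P.eval I = Q I := by
  obtain ⟨Λ, _, _, π, H⟩ := hQ (Set (Σ R : Out.Rel, Fin (Out.arity R)))
  -- The target for `R` excludes exactly the `R`-facts in which every position carries its own mark.
  choose 𝓑 hom arc using fun R : Out.Rel => H {f | ∀ t, f = ⟨R, t⟩ → ∃ i, ⟨R, i⟩ ∉ t i}
  let Δ : DualFamily In Out := ⟨Λ, fun R i l => ⟨R, i⟩ ∈ π l, 𝓑⟩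
  have hΔ : Δ.Detects Q := by
    refine ⟨fun R D _ I m hm => ?_, fun R B hB D I g hgne hg t ht => ?_⟩
    · obtain ⟨B, hB, g, hπ, hg⟩ := hom R D I (fun x => {q | ∃ i, q = ⟨R, i⟩ ∧ m i x}) (by
        rintro ⟨R', t'⟩ hf t h
        obtain rfl : R' = R := congrArg Fact.rel h
        cases h
        obtain ⟨i, hi⟩ := hm t' hf
        refine ⟨i, ?_⟩
        rintro ⟨i', h, hi'⟩
        cases h
        exact hi hi')
      refine ⟨B, hB, g, hg, fun i x => ?_⟩
      change _ ∈ π (g x) ↔ _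
      rw [hπ]
      constructor
      · rintro ⟨i', h, hi'⟩
        cases h
        exact hi'
      · exact fun h => ⟨i, rfl, h⟩
    · obtain ⟨⟨s, hs, hsg⟩, -⟩ := arc R B hB D I g hgne hg _ ht
      obtain ⟨i, hi⟩ := hs s rfl
      choose l hl hls using hsg
      refine ⟨l, hl, i, ?_⟩
      change _ ∉ π (l i)
      rwa [hls]
  have : Nonempty Δ.Label := ‹Nonempty Λ›
  exact ⟨Δ.program, Δ.isTAM_program, fun D _ I =>
    (hΔ.eval_subset I).antisymm (hΔ.subset_eval I (hact I))⟩

end Datalog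

theorem mainTheorem3 {In Mid Out : Datalog.Schema}
    (P₁ : Datalog.Program In Mid) (P₂ : Datalog.Program Mid Out)
    (h₁ : P₁.IsTAM) (h₂ : P₂.IsTAM) :
    ∃ P₃ : Datalog.Program In Out, P₃.IsTAM ∧
      ∀ (D : Type*) [Nonempty D] (I : Set (Datalog.Fact In D)), I.Finite →
        P₃.eval I = P₂.eval (P₁.eval I) := by
  obtain ⟨P₃, hP₃, heval⟩ := (h₁.hasFiniteDuals.comp h₂.hasFiniteDuals).exists_isTAM
    fun I => Datalog.Program.activeDomain_eval_subset.trans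
      Datalog.Program.activeDomain_eval_subset
  exact ⟨P₃, hP₃, fun D _ I _ => heval D I⟩
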